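/- Let $K$ be an arbitrary field, let $n\ge 2$ be an integer and let $G=\mathbb Z/n\mathbb Z$ be the cyclic group of order $n$. For a faithful finite-dimensional representation $G\to GL(V)$ over $K$, let $G$ act on the function field $K(V)$ (the fraction field of the symmetric algebra of $V^*$) by $K$-automorphisms through the dual action on $V^*$, and put $$\mathrm{ed}_K(G)=\min\{\operatorname{trdeg}_K E\},$$ where $E$ runs over all faithful $G$-subfields of $K(V)$, that is, all $G$-stable intermediate fields $K\subseteq E\subseteq K(V)$ for which the homomorphism $G\to\operatorname{Aut}_K(E)$ is injective. Then the following holds for every choice of the faithful finite-dimensional representation $V$ from which $\mathrm{ed}_K(G)$ is computed. (1) Suppose that $\operatorname{char}K\nmid n$ (that is, $\operatorname{char}K=0$, or $\operatorname{char}K=p>0$ and $p\nmid n$), and let $\zeta_n$ be any primitive $n$-th root of unity in an algebraic closure of $K$. If $n$ is odd, then $\mathrm{ed}_K(G)=1$ if and only if $\zeta_n+\zeta_n^{-1}\in K$. If $n$ is even, then $\mathrm{ed}_K(G)=1$ if and only if $\zeta_n\in K$. (2) Suppose that $\operatorname{char}K=p>0$ and $p\mid n$. Then $\mathrm{ed}_K(G)=1$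 if and only if $n=p$. -/

import Mathlib

namespace EssDim

noncomputable section

universe u v w

variable {K : Type u} {G : Type w} {V : Type v} [Field K] [Group G] [AddCommGroup V] [Module K V]

variable (K V) in
/-- The polynomial ring `K[V] = Sym(V*)` on the vector space `V`. -/
abbrev CoordRing := SymmetricAlgebra K (Module.Dual K V)

variable (K V) in
/-- The function field `K(V)`: the field of fractions of `K[V] = Sym(V*)`. If `x₁, …, x_m` is a
basis of `V*`, this is the field of rational functions `K(x₁, …, x_m)`. -/
abbrev FunField := FractionRing (CoordRing K V)

/-- The `K`-algebra endomorphism of `K[V]` induced by a linear endomorphism of `V*`. -/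
def symMap (f : Module.Dual K V →ₗ[K] Module.Dual K V) : CoordRing K V →ₐ[K] CoordRing K V :=
  SymmetricAlgebra.lift (SymmetricAlgebra.ι K (Module.Dual K V) ∘ₗ f)

theorem symMap_one : symMap (1 : Module.Dual K V →ₗ[K] Module.Dual K V) = AlgHom.id K _ := by
  apply SymmetricAlgebra.algHom_ext
  ext x
  simp [symMap]

theorem symMap_mul (f g : Module.Dual K V →ₗ[K] Module.Dual K V) :
    symMap (f * g) = (symMap f).comp (symMap g) := by
  apply SymmetricAlgebra.algHom_ext
  ext x
  simp [symMap]

/-- The action of `G` on `K[V]` by `K`-algebra automorphisms: the one that extends the dual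
(contragredient) action `(g • f)(v) = f (g⁻¹ v)` on the linear forms `f ∈ V*`. -/
def coordAction (ρ : Representation K G V) : G →* (CoordRing K V ≃ₐ[K] CoordRing K V) where
  toFun g := AlgEquiv.ofAlgHom (symMap (ρ.dual g)) (symMap (ρ.dual g⁻¹))
    (by rw [← symMap_mul, ← map_mul, mul_inv_cancel, map_one, symMap_one])
    (by rw [← symMap_mul, ← map_mul, inv_mul_cancel, map_one, symMap_one])
  map_one' := by
    apply AlgEquiv.ext
    intro x
    change symMap (ρ.dual 1) x = x
    rw [map_one, symMap_one]
    rfl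
  map_mul' g h := by
    apply AlgEquiv.ext
    intro x
    change symMap (ρ.dual (g * h)) x = symMap (ρ.dual g) (symMap (ρ.dual h) x)
    rw [map_mul, symMap_mul]
    rfl

/-- The action of `G` on the function field `K(V)` by `K`-automorphisms, which extends the one
on `K[V]`. -/
def funFieldAction (ρ : Representation K G V) : G →* (FunField K V ≃ₐ[K] FunField K V) :=
  (IsFractionRing.fieldEquivOfAlgEquivHom K (FunField K V)).comp (coordAction ρ)

/-- `E` is a faithful `G`-subfield of `K(V)`: an intermediate field of `K(V) / K` that is mapped
into itself by `G`, and such that only the identity of `G` acts trivially on it, that is,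
`G → Aut_K(E)` is injective. -/
structure IsFaithfulSubfield (ρ : Representation K G V)
    (E : IntermediateField K (FunField K V)) : Prop where
  stable : ∀ g : G, ∀ x ∈ E, funFieldAction ρ g x ∈ E
  faithful : ∀ g : G, (∀ x ∈ E, funFieldAction ρ g x = x) → g = 1

/-- The essential dimension `ed_K(G)`, computed from the representation `ρ : G → GL(V)` (which is
to be faithful and finite-dimensional): the least transcendence degree over `K` of a faithful
`G`-subfield of `K(V)`. For faithful `ρ` the field `K(V)` is itself a faithful `G`-subfield, so
that the minimum is taken over a non-empty set. -/
def essDim (ρ : Representation K G V) : ℕ :=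
  sInf {d : ℕ | ∃ E : IntermediateField K (FunField K V),
    IsFaithfulSubfield ρ E ∧ Algebra.trdeg K E = (d : Cardinal)}

end

end EssDim

/-! Write `σ` for the action of a generator of `G` on `K(V)`, an automorphism of order `n`. As `K`
is algebraically closed in `K(V)`, a field of transcendence degree zero carries no faithful action.
So `ed_K(G) = 1` means that some `σ`-stable `E` of transcendence degree one has `σ` of order `n` on
it.

Necessity of `ζ + ζ⁻¹ ∈ K`, or of `n = p`: embed `E` in `K(x₁, …, x_m)` and drop variables until `E`
lies in `F(X)` but not in `F`, where `F = K(x₁, …, x_r)`. The `x_i` stay independent over `E`, so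
`σ` extends to `E(x₁, …, x_r)` fixing `F`, and by Lüroth this field is a rational function field
over `F` (`exists_ratFunc_automorphism`). The extension is a Möbius transformation of order `n`
(`ratFunc_order_automorphism`). If its eigenvalues `l, m` differ, `l/m` is a primitive `n`-th root
of unity with `l/m + m/l ∈ F`; if they agree, the order is the characteristic. Elements of `F`
algebraic over `K` lie in `K`.

Necessity of `ζ ∈ K` for even `n`: let `T` be the involution of `V*` given by the `n/2`-th power of
the generator. Scaling its `-1`-eigenspace by a variable embeds `K(V)` equivariantly in Laurent
series, hence gives a valuation. It is nontrivial on `E` (`exists_isPrimitiveRoot_of_even`), so the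
transcendence degree forces the leading coefficients of elements of `E` of order zero into `K`. Then
`σ` scales the leading coefficient of a uniformizer of `E` by some `c ∈ K`, and faithfulness makes
`c` a primitive `n`-th root of unity (`exists_isPrimitiveRoot`).

Sufficiency: Dedekind's independence of characters gives a nonzero `w` killed by any chosen
nonconstant factor of `X ^ n - 1` at `σ` (`exists_annihilated`). The factor `X - ζ` gives `σ w = ζ
w`; the factor `X² - (ζ + ζ⁻¹) X + 1` gives `t = σ w / w` with `σ t = ζ + ζ⁻¹ - t⁻¹`. In
characteristic `p = n` a Jordan block gives `σ t = t + 1`. In each case `E` is generated by one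
element. -/

namespace EssDim

/-! ### Orders of Möbius transformations via Lucas sequences -/

section Mobius

variable {F L : Type*} [Field F] [Field L] [Algebra F L]

/-- The Lucas sequence of `Z² - T Z + D`. -/
def lucas (T D : F) : ℕ → F
  | 0 => 0
  | 1 => 1
  | k + 2 => T * lucas T D (k + 1) - D * lucas T D k

theorem lucas_ne_zero_of_succ_eq_zero {T D : F} (hD : D ≠ 0) :
    ∀ k, lucas T D (k + 1) = 0 → lucas T D k ≠ 0
  | 0, h => by simp [lucas] at h
  | k + 1, h => by
    intro h0
    have := lucas_ne_zero_of_succ_eq_zero hD k h0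
    rw [lucas, h0] at h
    simp_all

theorem lucas_mul_sub {R : Type*} [Field R] [Algebra F R] {T D : F} {l m : R}
    (h1 : l + m = algebraMap F R T) (h2 : l * m = algebraMap F R D) :
    ∀ k, algebraMap F R (lucas T D k) * (l - m) = l ^ k - m ^ k
  | 0 => by simp [lucas]
  | 1 => by simp [lucas]
  | k + 2 => by
    have e1 := lucas_mul_sub h1 h2 k
    have e2 := lucas_mul_sub h1 h2 (k + 1)
    rw [lucas, map_sub, map_mul, map_mul, ← h1, ← h2]
    linear_combination (l + m) * e2 - l * m * e1

theorem lucas_succ_of_double_root {R : Type*} [Field R] [Algebra F R] {T D : F} {l : R}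
    (h1 : l + l = algebraMap F R T) (h2 : l * l = algebraMap F R D) :
    ∀ k, algebraMap F R (lucas T D (k + 1)) = (k + 1) * l ^ k
  | 0 => by simp [lucas]
  | 1 => by simp [lucas, ← h1]; ring
  | k + 2 => by
    have e1 := lucas_succ_of_double_root h1 h2 k
    have e2 := lucas_succ_of_double_root h1 h2 (k + 1)
    rw [lucas, map_sub, map_mul, map_mul, ← h1, ← h2, e1, e2]
    push_cast
    ring

/-- By Cayley–Hamilton, the matrix `M = (a, b; c, d)` with Lucas sequence `u` satisfies `M ^ (k + 1)
= u (k + 1) M - det M · u k`. This is the action of that power on `X`, cleared of denominators. -/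
theorem mobius_iterate (τ : L ≃ₐ[F] L) (X : L) {a b c d : F}
    (h : τ X * (algebraMap F L c * X + algebraMap F L d) = algebraMap F L a * X + algebraMap F L b)
    (k : ℕ) :
    (τ ^ (k + 1)) X * (algebraMap F L (lucas (a + d) (a * d - b * c) (k + 1)) *
        (algebraMap F L c * X + algebraMap F L d) -
        algebraMap F L ((a * d - b * c) * lucas (a + d) (a * d - b * c) k)) =
      algebraMap F L (lucas (a + d) (a * d - b * c) (k + 1)) *
        (algebraMap F L a * X + algebraMap F L b) -
        algebraMap F L ((a * d - b * c) * lucas (a + d) (a * d - b * c) k) * X := by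
  induction k with
  | zero => simpa [lucas] using h
  | succ k ih =>
    have e := congrArg τ ih
    rw [map_mul, ← AlgEquiv.mul_apply, ← pow_succ'] at e
    simp only [map_sub, map_mul, map_add, AlgEquiv.commutes] at e h ⊢
    simp only [lucas, map_sub, map_mul, map_add]
    generalize (τ ^ (k + 1 + 1)) X = y at *
    generalize algebraMap F L (lucas (a + d) (a * d - b * c) (k + 1)) = u at *
    generalize algebraMap F L (lucas (a + d) (a * d - b * c) k) = v at *
    generalize τ X = x1 at *
    generalize algebraMap F L a = a at *
    generalize algebraMap F L b = b at *
    generalize algebraMap F L c = c at *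
    generalize algebraMap F L d = d at *
    linear_combination (c * X + d) * e + (u * a - (a * d - b * c) * v - y * u * c) * h

/-- The matrix is not scalar, since `τ` moves `X`; hence its `k`-th power is scalar exactly when the
coefficient of `M` in it vanishes. -/
theorem pow_apply_eq_self_iff_lucas (τ : L ≃ₐ[F] L) (X : L) {a b c d : F}
    (hQ : algebraMap F L c * X + algebraMap F L d ≠ 0) (hD : a * d - b * c ≠ 0)
    (h : τ X * (algebraMap F L c * X + algebraMap F L d) = algebraMap F L a * X + algebraMap F L b)
    (hX : τ X ≠ X) (k : ℕ) :
    (τ ^ k) X = X ↔ lucas (a + d) (a * d - b * c) k = 0 := by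
  cases k with
  | zero => simp [lucas]
  | succ k =>
    have e := mobius_iterate τ X h k
    constructor
    · intro hk
      rw [hk] at e
      have h1 : algebraMap F L (lucas (a + d) (a * d - b * c) (k + 1)) *
          ((X - τ X) * (algebraMap F L c * X + algebraMap F L d)) = 0 := by
        linear_combination e - algebraMap F L (lucas (a + d) (a * d - b * c) (k + 1)) * h
      rw [mul_eq_zero, mul_eq_zero, sub_eq_zero] at h1
      rcases h1 with h1 | h1 | h1
      · exact (map_eq_zero _).1 h1
      · exact absurd h1.symm hX
      · exact absurd h1 hQ
    · intro hk
      have h1 := lucas_ne_zero_of_succ_eq_zero hD k hk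
      rw [hk, map_zero, zero_mul, zero_mul, zero_sub, zero_sub, mul_neg, neg_inj, mul_comm] at e
      exact mul_left_cancel₀ ((map_ne_zero _).2 (mul_ne_zero hD h1)) e

theorem exists_add_mul_eq {R : Type*} [Field R] [IsAlgClosed R] (T D : R) :
    ∃ l m : R, l + m = T ∧ l * m = D := by
  obtain ⟨l, hl⟩ := IsAlgClosed.exists_root
    (Polynomial.C 1 * Polynomial.X ^ 2 + Polynomial.C (-T) * Polynomial.X + Polynomial.C D)
    (by rw [Polynomial.degree_quadratic one_ne_zero]; norm_num)
  refine ⟨l, T - l, by ring, ?_⟩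
  simp only [Polynomial.IsRoot, Polynomial.eval_add, Polynomial.eval_mul, Polynomial.eval_C,
    Polynomial.eval_pow, Polynomial.eval_X] at hl
  linear_combination -hl

/-- If a Möbius transformation over `F` has order `n`, then either `n` is prime to the
characteristic and the sum of a primitive `n`-th root of unity and its inverse lies in `F`, or `n`
is equal to the characteristic. -/
theorem mobius_order (p : ℕ) [CharP F p] {n : ℕ} (hn : 2 ≤ n) {T D : F} (hD : D ≠ 0)
    (h : ∀ k, lucas T D k = 0 ↔ n ∣ k) :
    (¬ p ∣ n → ∃ z : AlgebraicClosure F, IsPrimitiveRoot z n ∧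
      z + z⁻¹ ∈ (algebraMap F (AlgebraicClosure F)).range) ∧ (0 < p → p ∣ n → n = p) := by
  obtain ⟨l, m, h1, h2⟩ := exists_add_mul_eq (algebraMap F (AlgebraicClosure F) T)
    (algebraMap F (AlgebraicClosure F) D)
  have hD' : l * m ≠ 0 := by rw [h2]; exact (map_ne_zero _).2 hD
  have hl := left_ne_zero_of_mul hD'
  have hm := right_ne_zero_of_mul hD'
  have : CharP (AlgebraicClosure F) p := charP_of_injective_algebraMap
    (algebraMap F (AlgebraicClosure F)).injective p
  by_cases hlm : l = m
  · subst hlm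
    have hk : ∀ k, 0 < k → (p ∣ k ↔ n ∣ k) := by
      intro k hk
      obtain ⟨k, rfl⟩ : ∃ j, k = j + 1 := ⟨k - 1, by omega⟩
      rw [← h, ← map_eq_zero (algebraMap F (AlgebraicClosure F)),
        lucas_succ_of_double_root h1 h2, mul_eq_zero, or_iff_left (pow_ne_zero _ hl),
        ← CharP.cast_eq_zero_iff (AlgebraicClosure F) p]
      push_cast
      rfl
    have hpn : p ∣ n := (hk n (by omega)).2 dvd_rfl
    exact ⟨fun h => absurd hpn h, fun hp _ => Nat.dvd_antisymm ((hk p hp).1 dvd_rfl) hpn⟩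
  · have hk : ∀ k, (l / m) ^ k = 1 ↔ n ∣ k := by
      intro k
      rw [← h, ← map_eq_zero (algebraMap F (AlgebraicClosure F)), div_pow,
        div_eq_one_iff_eq (pow_ne_zero _ hm), ← sub_eq_zero, ← lucas_mul_sub h1 h2, mul_eq_zero,
        or_iff_left (sub_ne_zero.2 hlm)]
    have hz : IsPrimitiveRoot (l / m) n := ⟨(hk n).2 dvd_rfl, fun k => (hk k).1⟩
    -- `l/m + m/l = (l + m)² / (l m) - 2`.
    refine ⟨fun _ => ⟨_, hz, T ^ 2 / D - 2, ?_⟩, fun hp hpn => ?_⟩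
    · rw [map_sub, map_div₀, map_pow, ← h1, ← h2, map_ofNat]
      field_simp
      ring
    · exfalso
      have : Fact p.Prime := ⟨(CharP.char_is_prime_or_zero F p).resolve_right hp.ne'⟩
      obtain ⟨r, rfl⟩ := hpn
      have h3 : ((l / m) ^ r) ^ p = 1 := by rw [← pow_mul, mul_comm r p, hz.pow_eq_one]
      have h4 : (l / m) ^ r = 1 := by
        have : ((l / m) ^ r - 1) ^ p = 0 := by rw [sub_pow_char, h3, one_pow, sub_self]
        exact sub_eq_zero.1 (pow_eq_zero_iff (Nat.Prime.ne_zero Fact.out) |>.1 this)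
      have h5 := hz.dvd_of_pow_eq_one r h4
      have hr : 0 < r := by rcases Nat.eq_zero_or_pos r with rfl | h <;> omega
      have := Nat.le_of_dvd hr h5
      have := (Fact.out : p.Prime).two_le
      nlinarith

end Mobius

/-! ### Automorphisms of `F(X)` are Möbius transformations -/

section RatFunc

open IntermediateField

variable {F : Type*} [Field F]

/-- The image of `X` generates `F(X)`, and the degree of `F(X)` over the field generated by a
rational function is the larger of the degrees of its numerator and denominator. So both are at most
one. A zero determinant would make the image constant. -/
theorem ratFunc_exists_mobius (τ : RatFunc F ≃ₐ[F] RatFunc F) : ∃ a b c d : F,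
    algebraMap F (RatFunc F) c * RatFunc.X + algebraMap F (RatFunc F) d ≠ 0 ∧
    a * d - b * c ≠ 0 ∧
    τ RatFunc.X * (algebraMap F (RatFunc F) c * RatFunc.X + algebraMap F (RatFunc F) d) =
      algebraMap F (RatFunc F) a * RatFunc.X + algebraMap F (RatFunc F) b := by
  have htop : F⟮τ RatFunc.X⟯ = ⊤ := by
    rw [← Set.image_singleton, ← AlgEquiv.coe_toAlgHom, ← adjoin_map,
      RatFunc.adjoin_X, ← AlgHom.fieldRange_eq_map]
    exact AlgHom.fieldRange_eq_top.2 τ.surjective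
  have hdeg := (τ RatFunc.X).finrank_eq_max_natDegree
  rw [htop, IntermediateField.finrank_top] at hdeg
  have hnum := Polynomial.exists_eq_X_add_C_of_natDegree_le_one
    (hdeg ▸ le_max_left (τ RatFunc.X).num.natDegree _)
  have hden := Polynomial.exists_eq_X_add_C_of_natDegree_le_one
    (hdeg ▸ le_max_right _ (τ RatFunc.X).denom.natDegree)
  obtain ⟨a, b, hab⟩ := hnum
  obtain ⟨c, d, hcd⟩ := hden
  have e : ∀ u v : F, algebraMap (Polynomial F) (RatFunc F)
      (Polynomial.C u * Polynomial.X + Polynomial.C v) =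
      algebraMap F (RatFunc F) u * RatFunc.X + algebraMap F (RatFunc F) v := by
    intro u v
    simp [RatFunc.algebraMap_eq_C]
  have hQ : algebraMap F (RatFunc F) c * RatFunc.X + algebraMap F (RatFunc F) d ≠ 0 := by
    rw [← e, ← hcd]
    exact RatFunc.algebraMap_ne_zero (RatFunc.denom_ne_zero _)
  have hm : τ RatFunc.X * (algebraMap F (RatFunc F) c * RatFunc.X + algebraMap F (RatFunc F) d) =
      algebraMap F (RatFunc F) a * RatFunc.X + algebraMap F (RatFunc F) b := by
    rw [← e, ← e, ← hab, ← hcd, ← eq_div_iff (RatFunc.algebraMap_ne_zero (RatFunc.denom_ne_zero _)),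
      RatFunc.num_div_denom]
  refine ⟨a, b, c, d, hQ, fun hD => ?_, hm⟩
  have hconst : ∀ r : F, τ RatFunc.X ≠ algebraMap F (RatFunc F) r := by
    intro r hr
    rw [← τ.commutes, τ.injective.eq_iff] at hr
    exact RatFunc.transcendental_X (hr ▸ isAlgebraic_algebraMap r)
  by_cases hc : c = 0
  · subst hc
    have hd : d ≠ 0 := by rintro rfl; simp at hQ
    have ha : a = 0 := by simpa [hd] using hD
    subst ha
    apply hconst (b / d)
    rw [map_div₀, eq_div_iff ((map_ne_zero _).2 hd)]
    simpa using hm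
  · apply hconst (a / c)
    rw [map_div₀, eq_div_iff ((map_ne_zero _).2 hc)]
    have : (τ RatFunc.X * algebraMap F (RatFunc F) c - algebraMap F (RatFunc F) a) *
      (algebraMap F (RatFunc F) c * RatFunc.X + algebraMap F (RatFunc F) d) = 0 := by
      have hD' := congrArg (algebraMap F (RatFunc F)) hD
      simp only [map_sub, map_mul, map_zero] at hD'
      linear_combination algebraMap F (RatFunc F) c * hm - hD'
    rcases mul_eq_zero.1 this with h | h
    · exact sub_eq_zero.1 h
    · exact absurd h hQ

/-- The possible orders of the `F`-automorphisms of `F(X)`. -/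
theorem ratFunc_order_automorphism (p : ℕ) [CharP F p] {n : ℕ} (hn : 2 ≤ n)
    (τ : RatFunc F ≃ₐ[F] RatFunc F) (hτ : ∀ k, τ ^ k = 1 ↔ n ∣ k) :
    (¬ p ∣ n → ∃ z : AlgebraicClosure F, IsPrimitiveRoot z n ∧
      z + z⁻¹ ∈ (algebraMap F (AlgebraicClosure F)).range) ∧ (0 < p → p ∣ n → n = p) := by
  obtain ⟨a, b, c, d, hQ, hD, h⟩ := ratFunc_exists_mobius τ
  have hone : ∀ k, (τ ^ k) RatFunc.X = RatFunc.X ↔ τ ^ k = 1 := by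
    refine fun k => ⟨fun hk => ?_, fun hk => by rw [hk]; rfl⟩
    have : (τ ^ k).toAlgHom = AlgHom.id F _ := by
      apply IsLocalization.algHom_ext (A := Polynomial F) (nonZeroDivisors (Polynomial F))
      apply Polynomial.algHom_ext
      change (τ ^ k) (algebraMap (Polynomial F) (RatFunc F) Polynomial.X) =
        algebraMap (Polynomial F) (RatFunc F) Polynomial.X
      rw [RatFunc.algebraMap_X, hk]
    exact AlgEquiv.ext fun x => DFunLike.congr_fun this x
  refine mobius_order (T := a + d) p hn hD fun k => ?_
  rw [← pow_apply_eq_self_iff_lucas τ RatFunc.X hQ hD h, hone, hτ]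
  intro h1
  have := (hone 1).1 (by simpa using h1)
  have := Nat.le_of_dvd one_pos ((hτ 1).1 this)
  omega

end RatFunc

/-! ### The base field is algebraically closed in `K(x₁, …, x_m)` -/

section PurelyTranscendental

theorem ratFunc_mem_range_of_isAlgebraic {F : Type*} [Field F] {x : RatFunc F}
    (hx : IsAlgebraic F x) : x ∈ (algebraMap F (RatFunc F)).range := by
  by_contra h
  refine RatFunc.transcendental_of_ne_C x (fun ⟨c, hc⟩ => h ⟨c, ?_⟩) hx
  rw [hc, RatFunc.algebraMap_eq_C]

variable (K : Type*) [Field K]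

/-- The field of rational functions in `m` variables. -/
abbrev MvRatFunc (m : ℕ) := FractionRing (MvPolynomial (Fin m) K)

/-- `K(x₀, …, x_m)` as a field of rational functions in `x₀`. -/
noncomputable def mvRatFuncSucc (m : ℕ) : MvRatFunc K (m + 1) ≃ₐ[K] RatFunc (MvRatFunc K m) := by
  let φ : MvPolynomial (Fin (m + 1)) K →ₐ[K] RatFunc (MvRatFunc K m) :=
    (IsScalarTower.toAlgHom K (Polynomial (MvRatFunc K m)) (RatFunc (MvRatFunc K m))).comp
      ((Polynomial.mapAlgHom
        (IsScalarTower.toAlgHom K (MvPolynomial (Fin m) K) (MvRatFunc K m))).comp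
        (MvPolynomial.finSuccEquiv K m).toAlgHom)
  have hval : ∀ P, φ P = algebraMap (Polynomial (MvRatFunc K m)) (RatFunc (MvRatFunc K m))
      ((MvPolynomial.finSuccEquiv K m P).map
        (algebraMap (MvPolynomial (Fin m) K) (MvRatFunc K m))) := fun _ => rfl
  have hφ : Function.Injective φ := by
    intro a b hab
    rw [hval, hval] at hab
    exact (MvPolynomial.finSuccEquiv K m).injective (Polynomial.map_injective _
      (IsFractionRing.injective (MvPolynomial (Fin m) K) _) (RatFunc.algebraMap_injective _ hab))
  let ψ : MvRatFunc K (m + 1) →ₐ[K] RatFunc (MvRatFunc K m) := IsFractionRing.liftAlgHom hφ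
  refine AlgEquiv.ofBijective ψ ⟨ψ.toRingHom.injective, ?_⟩
  have hmem : ∀ P : Polynomial (MvPolynomial (Fin m) K),
      algebraMap _ (RatFunc (MvRatFunc K m)) (P.map (algebraMap _ (MvRatFunc K m))) ∈
        (IsFractionRing.liftAlgHom (K := MvRatFunc K (m + 1)) hφ).fieldRange := by
    intro P
    refine ⟨algebraMap _ _ ((MvPolynomial.finSuccEquiv K m).symm P), ?_⟩
    change IsFractionRing.liftAlgHom hφ _ = _
    rw [IsFractionRing.liftAlgHom_apply, IsFractionRing.lift_algebraMap]
    exact (hval _).trans (by rw [AlgEquiv.apply_symm_apply])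
  have hC : ∀ f : MvRatFunc K m, algebraMap _ (RatFunc (MvRatFunc K m)) (Polynomial.C f) ∈
        (IsFractionRing.liftAlgHom (K := MvRatFunc K (m + 1)) hφ).fieldRange := by
    intro f
    obtain ⟨a, b, -, rfl⟩ := IsFractionRing.div_surjective (A := MvPolynomial (Fin m) K) f
    have ha := hmem (Polynomial.C a)
    have hb := hmem (Polynomial.C b)
    rw [Polynomial.map_C, RatFunc.algebraMap_C] at ha hb
    rw [RatFunc.algebraMap_C, map_div₀]
    exact div_mem ha hb
  have hX := hmem Polynomial.X
  rw [Polynomial.map_X] at hX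
  have hP : ∀ P : Polynomial (MvRatFunc K m), algebraMap _ (RatFunc (MvRatFunc K m)) P ∈
      (IsFractionRing.liftAlgHom (K := MvRatFunc K (m + 1)) hφ).fieldRange := by
    intro P
    induction P using Polynomial.induction_on' with
    | add p q hp hq => rw [map_add]; exact add_mem hp hq
    | monomial n a =>
      rw [← Polynomial.C_mul_X_pow_eq_monomial, map_mul, map_pow]
      exact mul_mem (hC a) (pow_mem hX n)
  intro x
  rw [← RatFunc.num_div_denom x]
  exact div_mem (hP _) (hP _)

theorem mvRatFunc_zero_mem_range (x : MvRatFunc K 0) :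
    x ∈ (algebraMap K (MvRatFunc K 0)).range := by
  have h : ∀ a : MvPolynomial (Fin 0) K,
      algebraMap _ (MvRatFunc K 0) a ∈ (algebraMap K (MvRatFunc K 0)).range := by
    intro a
    rw [MvPolynomial.eq_C_of_isEmpty a]
    exact ⟨_, IsScalarTower.algebraMap_apply K (MvPolynomial (Fin 0) K) _ _⟩
  obtain ⟨a, b, -, rfl⟩ := IsFractionRing.div_surjective (A := MvPolynomial (Fin 0) K) x
  obtain ⟨a', ha⟩ := h a
  obtain ⟨b', hb⟩ := h b
  exact ⟨a' / b', by rw [map_div₀, ha, hb]⟩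

theorem mvRatFunc_mem_range_of_isAlgebraic (m : ℕ) {x : MvRatFunc K m} (hx : IsAlgebraic K x) :
    x ∈ (algebraMap K (MvRatFunc K m)).range := by
  induction m with
  | zero => exact mvRatFunc_zero_mem_range K x
  | succ m ih =>
    have h1 : IsAlgebraic K (mvRatFuncSucc K m x) := hx.algHom (mvRatFuncSucc K m).toAlgHom
    obtain ⟨f, hf⟩ := ratFunc_mem_range_of_isAlgebraic (h1.tower_top (MvRatFunc K m))
    rw [← hf, isAlgebraic_algebraMap_iff (algebraMap (MvRatFunc K m) _).injective] at h1
    obtain ⟨c, rfl⟩ := ih h1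
    refine ⟨c, (mvRatFuncSucc K m).injective ?_⟩
    rw [← hf, AlgEquiv.commutes, ← IsScalarTower.algebraMap_apply]

end PurelyTranscendental

/-! ### From an automorphism of `E` to one of a rational function field -/

section Descent

open IntermediateField

variable {K F ι : Type*} [Field K] [Field F] [Algebra K F]

/-- Since `e` is transcendental over `F`, the family `x` together with `e` is independent over `K`,
so `x` is independent over `K[e]`. As `E` has transcendence degree one, it is algebraic over `K[e]`,
and independence passes to it. -/
theorem algebraicIndependent_over_subfield {x : ι → F} (hx : AlgebraicIndependent K x)
    {L : Type*} [Field L] [Algebra K L] [Algebra F L] [IsScalarTower K F L]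
    (E : IntermediateField K L) (hE : Algebra.trdeg K E = 1) (e : E)
    (he : Transcendental F (e : L)) :
    AlgebraicIndependent E (fun i => algebraMap F L (x i)) := by
  have h1 : AlgebraicIndependent K
      (Sum.elim (![(e : L)] : Fin 1 → L) (fun i => algebraMap F L (x i))) := by
    refine AlgebraicIndependent.sumElim_of_tower (S := F) ?_ ?_
      (algebraicIndependent_iff_transcendental.2 he)
    · exact hx.map' (f := IsScalarTower.toAlgHom K F L) (algebraMap F L).injective
    · rintro _ ⟨i, rfl⟩
      exact ⟨_, rfl⟩
  have h2 : AlgebraicIndependent K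
      (Sum.elim (fun i => algebraMap F L (x i)) (![(e : L)] : Fin 1 → L)) := by
    have := h1.comp Sum.swap Sum.swap_leftInverse.injective
    rwa [show Sum.elim ![(e : L)] (fun i => algebraMap F L (x i)) ∘ Sum.swap =
      Sum.elim (fun i => algebraMap F L (x i)) ![(e : L)] by ext (i | i) <;> rfl] at this
  obtain ⟨h3, h4⟩ := AlgebraicIndependent.sumElim_iff.1 h2
  have h5 : AlgebraicIndependent K (![e] : Fin 1 → E) := by
    rw [algebraicIndependent_iff_transcendental] at h3 ⊢
    exact fun h => h3 (h.algHom E.val)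
  have h6 := (h5.isTranscendenceBasis_of_lift_trdeg_le_of_finite (by simp [hE])).isAlgebraic
  have hmem : ∀ z ∈ Algebra.adjoin K (Set.range (![e] : Fin 1 → E)),
      (z : L) ∈ Algebra.adjoin K (Set.range (![(e : L)] : Fin 1 → L)) := by
    intro z hz
    have := Subalgebra.mem_map.2 ⟨z, hz, (rfl : E.val z = E.val z)⟩
    rw [AlgHom.map_adjoin, ← Set.range_comp] at this
    rwa [show E.val ∘ ![e] = ![(e : L)] by ext i; fin_cases i; rfl] at this
  let f : Algebra.adjoin K (Set.range (![e] : Fin 1 → E)) →ₐ[K]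
      Algebra.adjoin K (Set.range (![(e : L)] : Fin 1 → L)) :=
    (E.val.comp (Subalgebra.val _)).codRestrict _ fun z => hmem _ z.2
  have h7 : AlgebraicIndependent (Algebra.adjoin K (Set.range (![e] : Fin 1 → E)))
      (fun i => algebraMap F L (x i)) := by
    refine AlgebraicIndependent.of_ringHom_of_comp_eq f (RingHom.id L) h4 ?_ ?_
    · intro a b hab
      have h := congrArg Subtype.val hab
      exact Subtype.ext (Subtype.ext h)
    · rfl
  exact h7.extendScalars E

/-- The automorphism of `E(x)` that extends the automorphism `σ` of `E` and fixes the
algebraically independent elements `x`. -/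
theorem exists_extend_automorphism {E L : Type*} [Field E] [Field L] [Algebra E L] {y : ι → L}
    (hy : AlgebraicIndependent E y) (σ : E ≃+* E) :
    ∃ s : adjoin E (Set.range y) ≃+* adjoin E (Set.range y),
      (∀ a, s (algebraMap E _ a) = algebraMap E _ (σ a)) ∧
      (∀ i, s ⟨y i, subset_adjoin E _ ⟨i, rfl⟩⟩ = ⟨y i, subset_adjoin E _ ⟨i, rfl⟩⟩) ∧
      ∀ k, s ^ k = 1 ↔ σ ^ k = 1 := by
  let q : adjoin E (Set.range y) ≃+* FractionRing (MvPolynomial ι E) :=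
    hy.aevalEquivField.symm.toRingEquiv
  let h := IsFractionRing.ringEquivOfRingEquivHom (MvPolynomial ι E)
    (FractionRing (MvPolynomial ι E)) (MvPolynomial.mapEquiv ι σ)
  let s : adjoin E (Set.range y) ≃+* adjoin E (Set.range y) := (q.trans h).trans q.symm
  have hC : ∀ a, s (algebraMap E _ a) = algebraMap E _ (σ a) := by
    intro a
    have h1 : q (algebraMap E _ a) = algebraMap _ _ (MvPolynomial.C a : MvPolynomial ι E) :=
      hy.aevalEquivField.symm.commutes a
    have h2 : h (algebraMap _ _ (MvPolynomial.C a : MvPolynomial ι E)) =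
        algebraMap _ _ (MvPolynomial.C (σ a) : MvPolynomial ι E) := by
      simp [h]
    change q.symm (h (q (algebraMap E _ a))) = _
    rw [h1, h2]
    exact hy.aevalEquivField.commutes (σ a)
  refine ⟨s, hC, fun i => ?_, fun k => ?_⟩
  · have h1 : q.symm (algebraMap _ _ (MvPolynomial.X i : MvPolynomial ι E)) =
        ⟨y i, subset_adjoin E _ ⟨i, rfl⟩⟩ := by
      apply Subtype.ext
      exact (hy.aevalEquivField_algebraMap_apply_coe _).trans (MvPolynomial.aeval_X _ _)
    rw [← h1]
    change q.symm (h (q (q.symm _))) = _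
    rw [RingEquiv.apply_symm_apply]
    simp [h]
  · have hk : ∀ k a, (s ^ k) (algebraMap E _ a) = algebraMap E _ ((σ ^ k) a) := by
      intro k
      induction k with
      | zero => intro a; rfl
      | succ k ih =>
        intro a
        rw [pow_succ, pow_succ, RingAut.mul_apply, RingAut.mul_apply, hC, ih]
    constructor
    · intro hs
      ext a
      have := hk k a
      rw [hs] at this
      exact ((algebraMap E (adjoin E (Set.range y))).injective this).symm
    · intro hσ
      have h1 : MvPolynomial.mapEquiv ι σ ^ k = 1 := by
        have h2 : ∀ k P, (MvPolynomial.mapEquiv ι σ ^ k) P = MvPolynomial.mapEquiv ι (σ ^ k) P := by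
          intro k
          induction k with
          | zero =>
            intro P
            exact (MvPolynomial.map_id P).symm
          | succ k ih =>
            intro P
            rw [pow_succ, pow_succ, RingAut.mul_apply, ih]
            exact MvPolynomial.map_map _ _ P
        ext P : 1
        rw [h2, hσ]
        exact MvPolynomial.map_id P
      have h3 : h ^ k = 1 := by rw [← map_pow, h1, map_one]
      have h4 : ∀ k z, (s ^ k) z = q.symm ((h ^ k) (q z)) := by
        intro k
        induction k with
        | zero => intro z; exact (q.symm_apply_apply z).symm
        | succ k ih =>
          intro z
          rw [pow_succ, pow_succ, RingAut.mul_apply, RingAut.mul_apply, ih]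
          change q.symm ((h ^ k) (q (q.symm (h (q z))))) = _
          rw [RingEquiv.apply_symm_apply]
      ext z : 1
      rw [h4, h3]
      exact q.symm_apply_apply z

theorem exists_ratFunc_automorphism {x : ι → F} (hx : AlgebraicIndependent K x)
    (hF : adjoin K (Set.range x) = ⊤) (E : IntermediateField K (RatFunc F))
    (hE : Algebra.trdeg K E = 1) (e : E)
    (he : (e : RatFunc F) ∉ (algebraMap F (RatFunc F)).range) (σ : E ≃ₐ[K] E) :
    ∃ τ : RatFunc F ≃ₐ[F] RatFunc F, ∀ k, τ ^ k = 1 ↔ σ ^ k = 1 := by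
  have he' : Transcendental F (e : RatFunc F) := fun h => he (ratFunc_mem_range_of_isAlgebraic h)
  have hy := algebraicIndependent_over_subfield hx E hE e he'
  set y := fun i => algebraMap F (RatFunc F) (x i)
  obtain ⟨s, hsC, hsy, hsk⟩ := exists_extend_automorphism hy σ.toRingEquiv
  -- `F` is generated over `K` by the `x i`, so it lies in `E(x)` and is fixed pointwise by `s`.
  have hfix : ∀ f : F, ∃ h : algebraMap F (RatFunc F) f ∈ adjoin E (Set.range y),
      s ⟨_, h⟩ = ⟨_, h⟩ := by
    intro f
    have hf : f ∈ adjoin K (Set.range x) := hF ▸ mem_top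
    induction hf using adjoin_induction with
    | mem f hf =>
      obtain ⟨i, rfl⟩ := hf
      exact ⟨_, hsy i⟩
    | algebraMap c =>
      have h1 : algebraMap F (RatFunc F) (algebraMap K F c) =
          algebraMap E (RatFunc F) (algebraMap K E c) := by
        rw [← IsScalarTower.algebraMap_apply, ← IsScalarTower.algebraMap_apply]
      have h : algebraMap F (RatFunc F) (algebraMap K F c) ∈ adjoin E (Set.range y) := by
        rw [h1]; exact (adjoin E (Set.range y)).algebraMap_mem _
      refine ⟨h, ?_⟩
      have h2 := hsC (algebraMap K E c)
      rw [show σ.toRingEquiv (algebraMap K E c) = algebraMap K E c from σ.commutes c] at h2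
      rw [show (⟨_, h⟩ : adjoin E (Set.range y)) = algebraMap E _ (algebraMap K E c) from
        Subtype.ext h1, h2]
    | add f g _ _ hf hg =>
      obtain ⟨hf, hf'⟩ := hf
      obtain ⟨hg, hg'⟩ := hg
      have h : algebraMap F (RatFunc F) (f + g) ∈ adjoin E (Set.range y) := by
        rw [map_add]; exact add_mem hf hg
      refine ⟨h, ?_⟩
      rw [show (⟨_, h⟩ : adjoin E (Set.range y)) = ⟨_, hf⟩ + ⟨_, hg⟩ from
        Subtype.ext (map_add _ _ _), map_add, hf', hg']
    | inv f _ hf =>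
      obtain ⟨hf, hf'⟩ := hf
      have h : algebraMap F (RatFunc F) f⁻¹ ∈ adjoin E (Set.range y) := by
        rw [map_inv₀]; exact inv_mem hf
      refine ⟨h, ?_⟩
      rw [show (⟨_, h⟩ : adjoin E (Set.range y)) = ⟨_, hf⟩⁻¹ from
        Subtype.ext (map_inv₀ _ _), map_inv₀, hf']
    | mul f g _ _ hf hg =>
      obtain ⟨hf, hf'⟩ := hf
      obtain ⟨hg, hg'⟩ := hg
      have h : algebraMap F (RatFunc F) (f * g) ∈ adjoin E (Set.range y) := by
        rw [map_mul]; exact mul_mem hf hg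
      refine ⟨h, ?_⟩
      rw [show (⟨_, h⟩ : adjoin E (Set.range y)) = ⟨_, hf⟩ * ⟨_, hg⟩ from
        Subtype.ext (map_mul _ _ _), map_mul, hf', hg']
  -- `E(x)` seen as an intermediate field of `F(X)/F`. It contains `e`, hence is not `F`, and
  -- Lüroth's theorem identifies it with `F(X)`.
  let M : IntermediateField F (RatFunc F) :=
    (adjoin E (Set.range y)).toSubfield.toIntermediateField fun f => (hfix f).1
  let s' : M ≃ₐ[F] M := AlgEquiv.ofRingEquiv (f := (s : M ≃+* M)) fun f => (hfix f).2
  have hs' : ∀ k (z : M), (s' ^ k) z = (s ^ k) z := by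
    intro k
    induction k with
    | zero => intro z; rfl
    | succ k ih =>
      have h1 : ∀ z : adjoin E (Set.range y), (s ^ (k + 1)) z = (s ^ k) (s z) := fun z => by
        rw [pow_succ]; rfl
      have h2 : ∀ z : M, (s' ^ (k + 1)) z = (s' ^ k) (s' z) := fun z => by rw [pow_succ]; rfl
      exact fun z => ((h2 z).trans (ih (s' z))).trans (h1 z).symm
  have hM : M ≠ ⊥ := by
    intro h
    have h1 : (e : RatFunc F) ∈ M := (adjoin E (Set.range y)).algebraMap_mem e
    rw [h] at h1
    exact he h1
  refine ⟨AlgEquiv.autCongr (RatFunc.Luroth.algEquiv hM).symm s', fun k => ?_⟩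
  rw [← map_pow, EmbeddingLike.map_eq_one_iff]
  have h1 : s' ^ k = 1 ↔ s ^ k = 1 :=
    ⟨fun h => RingEquiv.ext fun z => (hs' k z).symm.trans (by rw [h]; rfl),
      fun h => AlgEquiv.ext fun z => (hs' k z).trans (by rw [h]; rfl)⟩
  rw [h1, hsk]
  have h2 : ∀ k z, (σ.toRingEquiv ^ k) z = (σ ^ k) z := by
    intro k
    induction k with
    | zero => intro z; rfl
    | succ k ih => intro z; rw [pow_succ, pow_succ, RingAut.mul_apply, AlgEquiv.mul_apply, ih]; rfl
  exact ⟨fun h => AlgEquiv.ext fun z => (h2 k z).symm.trans (by rw [h]; rfl),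
      fun h => RingEquiv.ext fun z => (h2 k z).trans (by rw [h]; rfl)⟩

end Descent

/-! ### Orders of automorphisms of unirational fields of transcendence degree one -/

section CyclicActions

open IntermediateField

theorem pow_add_inv_pow_mem {R : Type*} [Field R] (S : Subring R) {z : R} (hz : z ≠ 0)
    (h : z + z⁻¹ ∈ S) : ∀ j : ℕ, z ^ j + (z⁻¹) ^ j ∈ S
  | 0 => by
    rw [pow_zero, pow_zero]
    exact add_mem (one_mem S) (one_mem S)
  | 1 => by simpa using h
  | j + 2 => by
    have h1 := pow_add_inv_pow_mem S hz h j
    have h2 := pow_add_inv_pow_mem S hz h (j + 1)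
    have h3 : z ^ (j + 2) + (z⁻¹) ^ (j + 2) =
        (z + z⁻¹) * (z ^ (j + 1) + (z⁻¹) ^ (j + 1)) - (z ^ j + (z⁻¹) ^ j) := by
      linear_combination -(z⁻¹ ^ j + z ^ j) * mul_inv_cancel₀ hz
    rw [h3]
    exact sub_mem (mul_mem h h2) h1

theorem IsPrimitiveRoot.pow_add_inv_mem {R : Type*} [Field R] (S : Subring R) {n : ℕ} (hn : 0 < n)
    {z w : R} (hz : IsPrimitiveRoot z n) (hw : IsPrimitiveRoot w n) (h : z + z⁻¹ ∈ S) :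
    w + w⁻¹ ∈ S := by
  have : NeZero n := ⟨hn.ne'⟩
  obtain ⟨j, -, rfl⟩ := hz.eq_pow_of_pow_eq_one hw.pow_eq_one
  rw [← inv_pow]
  exact pow_add_inv_pow_mem S (hz.ne_zero hn.ne') h j

/-- Sums `w + w⁻¹` over all primitive `n`-th roots `w` are polynomials in any one of them, so the
choice of root is immaterial. The sum for `ζ` therefore lies in `F` and is algebraic over `K`. -/
theorem add_inv_mem_range_of_extension {K F : Type*} [Field K] [Field F] [Algebra K F]
    (hF : ∀ x : F, IsAlgebraic K x → x ∈ (algebraMap K F).range) {n : ℕ} (hn : 0 < n)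
    {z : AlgebraicClosure F} (hz : IsPrimitiveRoot z n)
    (hzF : z + z⁻¹ ∈ (algebraMap F (AlgebraicClosure F)).range)
    {ζ : AlgebraicClosure K} (hζ : IsPrimitiveRoot ζ n) :
    ζ + ζ⁻¹ ∈ (algebraMap K (AlgebraicClosure K)).range := by
  let i : AlgebraicClosure K →ₐ[K] AlgebraicClosure F := IsAlgClosed.lift
  have hi : IsPrimitiveRoot (i ζ) n := hζ.map_of_injective i.toRingHom.injective
  obtain ⟨f, hf⟩ := IsPrimitiveRoot.pow_add_inv_mem _ hn hz hi hzF
  have hi' : i ζ + (i ζ)⁻¹ = i (ζ + ζ⁻¹) := by rw [map_add, map_inv₀]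
  have halg : IsAlgebraic K (algebraMap F (AlgebraicClosure F) f) := by
    rw [hf, hi']
    exact (Algebra.IsAlgebraic.isAlgebraic (ζ + ζ⁻¹)).algHom i
  rw [isAlgebraic_algebraMap_iff (algebraMap F (AlgebraicClosure F)).injective] at halg
  obtain ⟨k, rfl⟩ := hF f halg
  refine ⟨k, i.toRingHom.injective ?_⟩
  change i (algebraMap K _ k) = i (ζ + ζ⁻¹)
  rw [← hi', ← hf, AlgHom.commutes, ← IsScalarTower.algebraMap_apply]

theorem mvRatFunc_adjoin_X (K : Type*) [Field K] (m : ℕ) :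
    adjoin K (Set.range fun i : Fin m =>
      algebraMap (MvPolynomial (Fin m) K) (MvRatFunc K m) (MvPolynomial.X i)) = ⊤ := by
  rw [eq_top_iff]
  intro f _
  have h : ∀ a : MvPolynomial (Fin m) K, algebraMap _ (MvRatFunc K m) a ∈
      adjoin K (Set.range fun i : Fin m =>
        algebraMap (MvPolynomial (Fin m) K) (MvRatFunc K m) (MvPolynomial.X i)) := by
    intro a
    induction a using MvPolynomial.induction_on with
    | C c =>
      have := (adjoin K (Set.range fun i : Fin m =>
        algebraMap (MvPolynomial (Fin m) K) (MvRatFunc K m) (MvPolynomial.X i))).algebraMap_mem c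
      rwa [IsScalarTower.algebraMap_apply K (MvPolynomial (Fin m) K)] at this
    | add p q hp hq => rw [map_add]; exact add_mem hp hq
    | mul_X p i hp => rw [map_mul]; exact mul_mem hp (subset_adjoin K _ ⟨i, rfl⟩)
  obtain ⟨a, b, -, rfl⟩ := IsFractionRing.div_surjective (A := MvPolynomial (Fin m) K) f
  exact div_mem (h a) (h b)

/-- If a field of transcendence degree one inside a purely transcendental extension has an
automorphism of order `n`, then so has a rational function field in one variable over some
`K(x₁, …, x_m)`. -/
theorem exists_ratFunc_automorphism_of_embedding {K : Type*} [Field K] {n : ℕ}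
    {E : Type*} [Field E] [Algebra K E] (hE : Algebra.trdeg K E = 1) (σ : E ≃ₐ[K] E)
    (hσ : ∀ k, σ ^ k = 1 ↔ n ∣ k) (m : ℕ) (j : E →ₐ[K] MvRatFunc K m) :
    ∃ (r : ℕ) (τ : RatFunc (MvRatFunc K r) ≃ₐ[MvRatFunc K r] RatFunc (MvRatFunc K r)),
      ∀ k, τ ^ k = 1 ↔ n ∣ k := by
  induction m with
  | zero =>
    have h : Algebra.Transcendental K E := by
      rw [Algebra.transcendental_iff_not_isAlgebraic]
      intro h
      rw [trdeg_eq_zero] at hE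
      exact zero_ne_one hE
    obtain ⟨e, he⟩ := h.transcendental
    obtain ⟨c, hc⟩ := mvRatFunc_zero_mem_range K (j e)
    refine absurd ?_ he
    rw [← isAlgebraic_algHom_iff j j.toRingHom.injective, ← hc]
    exact isAlgebraic_algebraMap c
  | succ m ih =>
    let j' : E →ₐ[K] RatFunc (MvRatFunc K m) := (mvRatFuncSucc K m).toAlgHom.comp j
    let C := IsScalarTower.toAlgHom K (MvRatFunc K m) (RatFunc (MvRatFunc K m))
    -- Either the image of `E` does not involve the last adjoined variable, which can be dropped, or
    -- some element involves it and the descent applies at this stage.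
    by_cases h : ∀ e, j' e ∈ C.range
    · exact ih ((AlgEquiv.ofInjective C C.toRingHom.injective).symm.toAlgHom.comp
        (j'.codRestrict _ h))
    · push Not at h
      obtain ⟨e, he⟩ := h
      let q : E ≃ₐ[K] j'.fieldRange := AlgEquiv.ofInjectiveField j'
      have hx : AlgebraicIndependent K (fun i : Fin m =>
          algebraMap (MvPolynomial (Fin m) K) (MvRatFunc K m) (MvPolynomial.X i)) :=
        (MvPolynomial.algebraicIndependent_X (Fin m) K).map'
          (f := IsScalarTower.toAlgHom K (MvPolynomial (Fin m) K) (MvRatFunc K m))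
          (IsFractionRing.injective (MvPolynomial (Fin m) K) _)
      have htr : Algebra.trdeg K j'.fieldRange = 1 := by
        have := q.lift_trdeg_eq
        rw [hE, Cardinal.lift_one] at this
        simpa using this.symm
      obtain ⟨τ, hτ⟩ := exists_ratFunc_automorphism hx (mvRatFunc_adjoin_X K m) j'.fieldRange
        htr (q e) he (AlgEquiv.autCongr q σ)
      refine ⟨m, τ, fun k => ?_⟩
      rw [hτ, ← map_pow, EmbeddingLike.map_eq_one_iff, hσ]

theorem order_of_embedding {K : Type*} [Field K] (p : ℕ) [CharP K p] {n : ℕ} (hn : 2 ≤ n)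
    {E : Type*} [Field E] [Algebra K E] (hE : Algebra.trdeg K E = 1) (σ : E ≃ₐ[K] E)
    (hσ : ∀ k, σ ^ k = 1 ↔ n ∣ k) {m : ℕ} (j : E →ₐ[K] MvRatFunc K m) :
    (¬ p ∣ n → ∀ ζ : AlgebraicClosure K, IsPrimitiveRoot ζ n →
      ζ + ζ⁻¹ ∈ (algebraMap K (AlgebraicClosure K)).range) ∧ (0 < p → p ∣ n → n = p) := by
  obtain ⟨r, τ, hτ⟩ := exists_ratFunc_automorphism_of_embedding hE σ hσ m j
  have : CharP (MvRatFunc K r) p := charP_of_injective_algebraMap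
    (algebraMap K (MvRatFunc K r)).injective p
  obtain ⟨h1, h2⟩ := ratFunc_order_automorphism p hn τ hτ
  refine ⟨fun hp ζ hζ => ?_, h2⟩
  obtain ⟨z, hz, hzF⟩ := h1 hp
  exact add_inv_mem_range_of_extension
    (fun x hx => mvRatFunc_mem_range_of_isAlgebraic K r hx) (by omega) hz hzF hζ

end CyclicActions

/-! ### Algebraic relations in transcendence degree one -/

section Dependence

/-- The value of a polynomial in `X` over `K[Y]` at `X = a`, `Y = b`. -/
noncomputable def evalPair {K A : Type*} [CommRing K] [CommRing A] (κ : K →+* A) (a b : A) :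
    Polynomial (MvPolynomial (Fin 1) K) →+* A :=
  Polynomial.eval₂RingHom (MvPolynomial.eval₂Hom κ ![b]) a

theorem evalPair_finSuccEquiv {K A : Type*} [CommRing K] [CommRing A] (κ : K →+* A) (a b : A)
    (q : MvPolynomial (Fin 2) K) :
    evalPair κ a b (MvPolynomial.finSuccEquiv K 1 q) = MvPolynomial.eval₂Hom κ ![a, b] q := by
  have : (evalPair κ a b).comp (MvPolynomial.finSuccEquiv K 1).toRingEquiv.toRingHom =
      MvPolynomial.eval₂Hom κ ![a, b] := by
    apply MvPolynomial.ringHom_ext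
    · intro c
      simp [evalPair, MvPolynomial.finSuccEquiv_apply]
    · intro i
      fin_cases i
      · simp [evalPair, MvPolynomial.finSuccEquiv_apply]
      · change evalPair κ a b (MvPolynomial.finSuccEquiv K 1 (MvPolynomial.X (Fin.succ 0))) = _
        rw [MvPolynomial.finSuccEquiv_X_succ]
        simp [evalPair]
  exact DFunLike.congr_fun this q

theorem map_evalPair {K A B : Type*} [CommRing K] [CommRing A] [CommRing B] (κ : K →+* A)
    (g : A →+* B) (a b : A) (P : Polynomial (MvPolynomial (Fin 1) K)) :
    g (evalPair κ a b P) = evalPair (g.comp κ) (g a) (g b) P := by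
  simp only [evalPair, Polynomial.coe_eval₂RingHom]
  rw [Polynomial.hom_eval₂, MvPolynomial.comp_eval₂Hom]
  congr 2
  ext i
  fin_cases i
  rfl

/-- In a field of transcendence degree one any two elements satisfy a relation that involves the
second one even after the first one is set to zero. -/
theorem exists_evalPair_eq_zero {K E : Type*} [Field K] [Field E] [Algebra K E]
    (hE : Algebra.trdeg K E = 1) {a b : E} (ha : a ≠ 0) :
    ∃ P : Polynomial (MvPolynomial (Fin 1) K), P.coeff 0 ≠ 0 ∧
      evalPair (algebraMap K E) a b P = 0 := by
  have h : ¬ AlgebraicIndependent K (![a, b] : Fin 2 → E) := by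
    intro h
    have := h.lift_cardinalMk_le_trdeg
    rw [hE] at this
    norm_num at this
  rw [algebraicIndependent_iff] at h
  push Not at h
  obtain ⟨q, hq, hq0⟩ := h
  have hF : MvPolynomial.finSuccEquiv K 1 q ≠ 0 := by simpa using hq0
  -- Removing the highest power of `X` leaves a nonzero constant coefficient; the power can be
  -- cancelled at `a` because `a ≠ 0`.
  obtain ⟨P, hP, hP0⟩ := Polynomial.exists_eq_pow_rootMultiplicity_mul_and_not_dvd _ hF 0
  rw [Polynomial.C_0, sub_zero] at hP hP0
  refine ⟨P, fun h => hP0 (Polynomial.X_dvd_iff.2 h), ?_⟩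
  have h1 := evalPair_finSuccEquiv (algebraMap K E) a b q
  rw [hP, map_mul, map_pow] at h1
  have h2 : MvPolynomial.eval₂Hom (algebraMap K E) ![a, b] q = 0 := hq
  rw [h2] at h1
  refine (mul_eq_zero.1 h1).resolve_left (pow_ne_zero _ ?_)
  simpa [evalPair] using ha

end Dependence

theorem pow_apply_mem {K L : Type*} [Field K] [Field L] [Algebra K L] {σ : L ≃ₐ[K] L}
    {E : IntermediateField K L} (hσE : ∀ x ∈ E, σ x ∈ E) (k : ℕ) : ∀ x ∈ E, (σ ^ k) x ∈ E := by
  induction k with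
  | zero => exact fun x hx => hx
  | succ k ih =>
    intro x hx
    rw [pow_succ']
    exact hσE _ (ih x hx)

/-! ### Leading coefficients under an equivariant embedding in Laurent series -/

section LeadingCoefficients

variable {K L : Type*} [Field K] [Field L] [Algebra K L] (Φ : L →+* HahnSeries ℤ L)

theorem exists_ofPowerSeries_eq {x : HahnSeries ℤ L} (hx : 0 ≤ x.order) :
    ∃ f : PowerSeries L, HahnSeries.ofPowerSeries ℤ L f = x ∧
      PowerSeries.constantCoeff f = x.coeff 0 := by
  obtain ⟨k, hk⟩ := Int.eq_ofNat_of_zero_le hx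
  have h : HahnSeries.ofPowerSeries ℤ L (PowerSeries.X ^ k * LaurentSeries.powerSeriesPart x) =
      x := by
    rw [map_mul, HahnSeries.ofPowerSeries_X_pow, LaurentSeries.ofPowerSeries_powerSeriesPart,
      ← mul_assoc, HahnSeries.single_mul_single, hk]
    simp
  refine ⟨_, h, ?_⟩
  conv_rhs => rw [← h]
  rw [← PowerSeries.coeff_zero_eq_constantCoeff_apply]
  exact (HahnSeries.ofPowerSeries_apply_coeff _ 0).symm

/-- Take a relation `P(π, e) = 0` with `P(0, Y) ≠ 0`. Both expansions are power series and that of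
`π` has no constant term, so setting the variable to zero leaves a nontrivial equation for the
constant term of `e`. -/
theorem coeff_zero_isAlgebraic (hK : ∀ c, Φ (algebraMap K L c) = HahnSeries.C (algebraMap K L c))
    (E : IntermediateField K L) (hE : Algebra.trdeg K E = 1) (e π : E)
    (he : 0 ≤ (Φ e).order) (hπ : 0 < (Φ π).order) : IsAlgebraic K ((Φ e).coeff 0) := by
  have hπ0 : π ≠ 0 := by
    rintro rfl
    simp at hπ
  obtain ⟨P, hP0, hP⟩ := exists_evalPair_eq_zero hE (b := e) hπ0
  obtain ⟨f, hf, hf0⟩ := exists_ofPowerSeries_eq he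
  obtain ⟨g, hg, hg0⟩ := exists_ofPowerSeries_eq hπ.le
  have hg0' : PowerSeries.constantCoeff g = 0 := by
    rw [hg0]
    exact HahnSeries.coeff_eq_zero_of_lt_order hπ
  have h1 := congrArg (Φ.comp (algebraMap E L)) hP
  rw [map_evalPair, map_zero] at h1
  have h2 : evalPair ((PowerSeries.C (R := L)).comp (algebraMap K L)) g f P = 0 := by
    apply HahnSeries.ofPowerSeries_injective (Γ := ℤ)
    have hκ : (HahnSeries.ofPowerSeries ℤ L).comp ((PowerSeries.C (R := L)).comp
        (algebraMap K L)) = (Φ.comp (algebraMap E L)).comp (algebraMap K E) := by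
      refine RingHom.ext fun c => ?_
      rw [RingHom.comp_apply, RingHom.comp_apply, HahnSeries.ofPowerSeries_C, ← hK]
      rfl
    rw [map_evalPair, map_zero, hf, hg, hκ]
    exact h1
  have h3 := congrArg PowerSeries.constantCoeff h2
  rw [map_evalPair, map_zero, hg0', hf0] at h3
  by_contra hu
  have hu' := algebraicIndependent_iff_transcendental.2 hu
  refine hP0 (algebraicIndependent_iff.1 hu' _ ?_)
  rw [evalPair, Polynomial.coe_eval₂RingHom, Polynomial.eval₂_at_zero] at h3
  rw [← h3]
  rfl

theorem order_eq_and_leadingCoeff_eq {σ : L ≃+* L} {x y : HahnSeries ℤ L}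
    (h : ∀ i, y.coeff i = σ (x.coeff i)) :
    y.order = x.order ∧ y.leadingCoeff = σ x.leadingCoeff := by
  by_cases hx : x = 0
  · have hy : y = 0 := by
      ext i
      simp [h, hx]
    simp [hx, hy]
  have hx' : x.coeff x.order ≠ 0 := HahnSeries.coeff_order_eq_zero.not.2 hx
  have hy : y ≠ 0 := by
    rintro rfl
    have := h x.order
    rw [HahnSeries.coeff_zero, eq_comm, map_eq_zero_iff σ σ.injective] at this
    exact hx' this
  have hy' : y.coeff y.order ≠ 0 := HahnSeries.coeff_order_eq_zero.not.2 hy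
  have h1 : y.order = x.order := by
    apply le_antisymm
    · apply HahnSeries.order_le_of_coeff_ne_zero
      rw [h]
      exact (map_ne_zero_iff σ σ.injective).2 hx'
    · apply HahnSeries.order_le_of_coeff_ne_zero
      rw [h] at hy'
      exact (map_ne_zero_iff σ σ.injective).1 hy'
  exact ⟨h1, by rw [HahnSeries.leadingCoeff_eq, HahnSeries.leadingCoeff_eq, h, h1]⟩

theorem order_inv {x : HahnSeries ℤ L} (hx : x ≠ 0) : (x⁻¹).order = -x.order := by
  have := HahnSeries.order_mul hx (inv_ne_zero hx)
  rw [mul_inv_cancel₀ hx, HahnSeries.order_one] at this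
  omega

theorem order_zpow {x : HahnSeries ℤ L} (hx : x ≠ 0) (k : ℤ) : (x ^ k).order = k * x.order := by
  obtain ⟨k, rfl | rfl⟩ := k.eq_nat_or_neg
  · simp [HahnSeries.order_pow]
  · rw [zpow_neg, zpow_natCast, order_inv (pow_ne_zero _ hx), HahnSeries.order_pow]
    simp

/-- The leading coefficient as a multiplicative map. -/
noncomputable def leadHom : L →*₀ L where
  toFun e := (Φ e).leadingCoeff
  map_zero' := by simp
  map_one' := by simp
  map_mul' x y := by rw [map_mul, HahnSeries.leadingCoeff_mul]

theorem leadHom_mem_range (hcl : ∀ x : L, IsAlgebraic K x → x ∈ (algebraMap K L).range)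
    (hK : ∀ c, Φ (algebraMap K L c) = HahnSeries.C (algebraMap K L c))
    {E : IntermediateField K L} (hE : Algebra.trdeg K E = 1)
    (hv : ∃ π ∈ E, (Φ π).order ≠ 0) {e : L} (he : e ∈ E) (hve : (Φ e).order = 0) :
    leadHom Φ e ∈ (algebraMap K L).range := by
  obtain ⟨π, hπE, hπ⟩ := hv
  obtain ⟨π, hπE, hπ⟩ : ∃ π ∈ E, 0 < (Φ π).order := by
    rcases lt_or_gt_of_ne hπ with h | h
    · refine ⟨π⁻¹, inv_mem hπE, ?_⟩
      have : Φ π ≠ 0 := by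
        intro h0
        simp [h0] at h
      rw [map_inv₀, order_inv this]
      omega
    · exact ⟨π, hπE, h⟩
  have := coeff_zero_isAlgebraic Φ hK E hE ⟨e, he⟩ ⟨π, hπE⟩ hve.ge hπ
  apply hcl
  change IsAlgebraic K (Φ e).leadingCoeff
  rwa [HahnSeries.leadingCoeff_eq, hve]

/-- A tame ramification argument: elements of `E` of order zero have leading coefficient in `K`, so
`σ` acts on leading coefficients through the scalar `c` by which it moves that of a uniformizer. If
`c ^ j = 1`, then `σ ^ j` preserves all leading coefficients, and since `n` is invertible in `K` it
must be trivial on `E`. -/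
theorem exists_isPrimitiveRoot (hcl : ∀ x : L, IsAlgebraic K x → x ∈ (algebraMap K L).range)
    (hK : ∀ c, Φ (algebraMap K L c) = HahnSeries.C (algebraMap K L c))
    {E : IntermediateField K L} (hE : Algebra.trdeg K E = 1)
    (hv : ∃ π ∈ E, (Φ π).order ≠ 0)
    (σ : L ≃ₐ[K] L) (hΦ : ∀ e i, (Φ (σ e)).coeff i = σ ((Φ e).coeff i))
    (hσE : ∀ x ∈ E, σ x ∈ E) {n : ℕ} (hnK : (n : K) ≠ 0) (hσn : σ ^ n = 1)
    (hfaith : ∀ k, (∀ x ∈ E, (σ ^ k) x = x) → n ∣ k) : ∃ c : K, IsPrimitiveRoot c n := by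
  have hΦ0 : ∀ {x : L}, x ≠ 0 → Φ x ≠ 0 := fun hx => (map_ne_zero Φ).2 hx
  have hord : ∀ e, (Φ (σ e)).order = (Φ e).order := fun e =>
    (order_eq_and_leadingCoeff_eq (σ := σ.toRingEquiv) (hΦ e)).1
  have hlead : ∀ e, leadHom Φ (σ e) = σ (leadHom Φ e) := fun e =>
    (order_eq_and_leadingCoeff_eq (σ := σ.toRingEquiv) (hΦ e)).2
  have hpE := fun k => pow_apply_mem hσE k
  have hpord : ∀ k e, (Φ ((σ ^ k) e)).order = (Φ e).order := by
    intro k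
    induction k with
    | zero => exact fun e => rfl
    | succ k ih =>
      intro e
      rw [pow_succ', AlgEquiv.mul_apply, hord, ih]
  let H : AddSubgroup ℤ :=
    { carrier := {k | ∃ e ∈ E, e ≠ 0 ∧ (Φ e).order = k}
      zero_mem' := ⟨1, one_mem E, one_ne_zero, by simp⟩
      add_mem' := by
        rintro _ _ ⟨e, he, he0, rfl⟩ ⟨f, hf, hf0, rfl⟩
        exact ⟨e * f, mul_mem he hf, mul_ne_zero he0 hf0, by
          rw [map_mul, HahnSeries.order_mul (hΦ0 he0) (hΦ0 hf0)]⟩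
      neg_mem' := by
        rintro _ ⟨e, he, he0, rfl⟩
        exact ⟨e⁻¹, inv_mem he, inv_ne_zero he0, by rw [map_inv₀, order_inv (hΦ0 he0)]⟩ }
  obtain ⟨a, ha⟩ := Int.subgroup_cyclic H
  rw [← AddSubgroup.zmultiples_eq_closure] at ha
  -- `a` generates the value group of `E`, so `π` is a uniformizer up to inversion.
  obtain ⟨π, hπE, hπ0, hπ⟩ : a ∈ H := ha ▸ AddSubgroup.mem_zmultiples a
  have hdvd : ∀ e ∈ E, e ≠ 0 → ∃ k : ℤ, (Φ e).order = k * a := by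
    intro e he he0
    have : (Φ e).order ∈ H := ⟨e, he, he0, rfl⟩
    rw [ha, Int.mem_zmultiples_iff] at this
    obtain ⟨k, hk⟩ := this
    exact ⟨k, by rw [hk, mul_comm]⟩
  have hmem := fun {e : L} => leadHom_mem_range Φ hcl hK hE hv (e := e)
  have hlπ : leadHom Φ π ≠ 0 := (map_ne_zero _).2 hπ0
  obtain ⟨c, hc⟩ : leadHom Φ (σ π / π) ∈ (algebraMap K L).range := by
    refine hmem (div_mem (hσE π hπE) hπE) ?_
    rw [map_div₀, div_eq_mul_inv, HahnSeries.order_mul (hΦ0 ((map_ne_zero σ).2 hπ0))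
      (inv_ne_zero (hΦ0 hπ0)), order_inv (hΦ0 hπ0), hord, add_neg_cancel]
  have hcπ : leadHom Φ (σ π) = algebraMap K L c * leadHom Φ π := by
    rw [hc, map_div₀, div_mul_cancel₀ _ hlπ]
  -- `e / π ^ k` has order zero, so its leading coefficient lies in `K` and is fixed by `σ`.
  have hstep : ∀ e ∈ E, e ≠ 0 → ∀ k : ℤ, (Φ e).order = k * a →
      leadHom Φ (σ e) = algebraMap K L (c ^ k) * leadHom Φ e := by
    intro e he he0 k hk
    have h1 : leadHom Φ (e / π ^ k) ∈ (algebraMap K L).range := by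
      refine hmem (div_mem he (zpow_mem hπE k)) ?_
      rw [map_div₀, div_eq_mul_inv, map_zpow₀, HahnSeries.order_mul (hΦ0 he0)
        (inv_ne_zero (zpow_ne_zero _ (hΦ0 hπ0))), order_inv (zpow_ne_zero _ (hΦ0 hπ0)),
        order_zpow (hΦ0 hπ0), hπ, hk, add_neg_cancel]
    obtain ⟨d, hd⟩ := h1
    have h2 := hlead (e / π ^ k)
    rw [← hd, AlgEquiv.commutes, hd, map_div₀, map_div₀, map_zpow₀, map_zpow₀, map_div₀,
      map_zpow₀, hcπ, mul_zpow] at h2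
    have hc0 : algebraMap K L c ≠ 0 := by
      rw [hc]
      exact (map_ne_zero _).2 (div_ne_zero ((map_ne_zero σ).2 hπ0) hπ0)
    rw [map_zpow₀]
    have h3 := zpow_ne_zero k hc0
    have h4 := zpow_ne_zero k hlπ
    field_simp at h2
    linear_combination h2
  have hpow : ∀ e ∈ E, e ≠ 0 → ∀ k : ℤ, (Φ e).order = k * a → ∀ i : ℕ,
      leadHom Φ ((σ ^ i) e) = algebraMap K L ((c ^ k) ^ i) * leadHom Φ e := by
    intro e he he0 k hk i
    induction i with
    | zero => simp
    | succ i ih =>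
      rw [pow_succ', AlgEquiv.mul_apply, hstep _ (hpE i e he) ((map_ne_zero _).2 he0) k
        ((hpord i e).trans hk), ih, ← mul_assoc, ← map_mul, ← pow_succ']
  refine ⟨c, ?_, fun j hj => hfaith j fun x hx => ?_⟩
  · have h1 := hpow π hπE hπ0 1 (by rw [hπ, one_mul]) n
    rw [hσn, zpow_one] at h1
    have h2 : algebraMap K L (c ^ n) = 1 := mul_right_cancel₀ hlπ (h1.symm.trans (one_mul _).symm)
    exact (algebraMap K L).injective (h2.trans (map_one _).symm)
  · by_contra hne
    set f := (σ ^ j) x - x with hf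
    have hf0 : f ≠ 0 := sub_ne_zero.2 hne
    have hfE : f ∈ E := sub_mem (hpE j x hx) hx
    obtain ⟨k, hk⟩ := hdvd f hfE hf0
    -- The sum telescopes, as `σ ^ (j * n) = 1`. All `n` summands have the same order and leading
    -- coefficient, so the coefficient there is `n` times that of `f`, which is nonzero.
    have h1 : ∑ i ∈ Finset.range n, (σ ^ (j * i)) f = 0 := by
      have h2 : ∀ i, (σ ^ (j * i)) f = (σ ^ (j * (i + 1))) x - (σ ^ (j * i)) x := by
        intro i
        rw [hf, map_sub, ← AlgEquiv.mul_apply, ← pow_add, mul_add, mul_one]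
      simp_rw [h2]
      rw [Finset.sum_range_sub (fun i => (σ ^ (j * i)) x), mul_comm j n, pow_mul, hσn, one_pow,
        mul_zero, pow_zero, sub_self]
    have h3 : ∀ i, (Φ ((σ ^ (j * i)) f)).coeff (Φ f).order = leadHom Φ f := by
      intro i
      have h4 := hpow f hfE hf0 k hk (j * i)
      have h6 : (c ^ k) ^ (j * i) = 1 := by
        rw [← zpow_natCast, ← zpow_mul, mul_comm, zpow_mul, zpow_natCast, pow_mul, hj, one_pow,
          one_zpow]
      rw [h6, map_one, one_mul] at h4
      rw [← h4, ← hpord (j * i) f]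
      exact HahnSeries.leadingCoeff_eq.symm
    have h5 := congrArg (fun y => (Φ y).coeff (Φ f).order) h1
    simp only [map_sum, HahnSeries.coeff_sum, h3, map_zero, HahnSeries.coeff_zero,
      Finset.sum_const, Finset.card_range, nsmul_eq_mul] at h5
    rcases mul_eq_zero.1 h5 with h | h
    · rw [← map_natCast (algebraMap K L), map_eq_zero] at h
      exact hnK h
    · exact (map_ne_zero (leadHom Φ)).2 hf0 h

end LeadingCoefficients

/-! ### Construction of faithful subfields generated by one element -/

section Construction

open IntermediateField Polynomial

theorem trdeg_adjoin_transcendental {K L : Type*} [Field K] [Field L] [Algebra K L] {t : L}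
    (ht : Transcendental K t) : Algebra.trdeg K K⟮t⟯ = 1 := by
  have h1 : Algebra.trdeg K (RatFunc K) = 1 := by
    have : Algebra.IsAlgebraic K[X] (RatFunc K) := IsLocalization.isAlgebraic (RatFunc K)
      (nonZeroDivisors K[X])
    have h := trdeg_add_eq K K[X] (A := RatFunc K)
    rwa [trdeg_eq_zero (R := K[X]), Polynomial.trdeg_of_isDomain, add_zero, eq_comm] at h
  have h2 := (RatFunc.algEquivOfTranscendental t ht).lift_trdeg_eq
  rw [h1, Cardinal.lift_one] at h2
  simpa using h2.symm

variable {K L : Type*} [Field K] [Field L] [Algebra K L]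

/-- The element `t` is moved by `σ`, so it is not in `K` and is transcendental by `hcl`. -/
theorem exists_faithful_of_generator
    (hcl : ∀ x : L, IsAlgebraic K x → x ∈ (algebraMap K L).range) (σ : L ≃ₐ[K] L) {n : ℕ}
    {t : L} (ht : σ t ≠ t) (hσt : σ t ∈ K⟮t⟯) (hn : ∀ k, (σ ^ k) t = t → n ∣ k) :
    ∃ E : IntermediateField K L, (∀ x ∈ E, σ x ∈ E) ∧
      (∀ k, (∀ x ∈ E, (σ ^ k) x = x) → n ∣ k) ∧ Algebra.trdeg K E = 1 := by
  refine ⟨K⟮t⟯, ?_, fun k hk => hn k (hk t (mem_adjoin_simple_self K t)),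
    trdeg_adjoin_transcendental fun h => ?_⟩
  · have : K⟮t⟯ ≤ K⟮t⟯.comap σ.toAlgHom := by
      rw [adjoin_simple_le_iff]
      exact hσt
    exact this
  · obtain ⟨c, rfl⟩ := hcl t h
    exact ht (σ.commutes c)

theorem toLinearMap_pow_apply (σ : L ≃ₐ[K] L) (i : ℕ) (x : L) :
    (σ.toLinearMap ^ i) x = (σ ^ i) x := by
  induction i generalizing x with
  | zero => rfl
  | succ i ih =>
    rw [pow_succ, pow_succ, Module.End.mul_apply, AlgEquiv.mul_apply, ih]
    rfl

/-- Dedekind: the powers `σ ^ i` with `i < n` are distinct characters, hence linearly independent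
over `L`. -/
theorem exists_aeval_apply_ne_zero (σ : L ≃ₐ[K] L) {n : ℕ} (hσ : ∀ k, σ ^ k = 1 → n ∣ k)
    {Q : K[X]} (hQ : Q ≠ 0) (hdeg : Q.natDegree < n) :
    ∃ x, aeval σ.toLinearMap Q x ≠ 0 := by
  by_contra! h
  have hinj : Function.Injective fun i : Fin n => ((σ ^ (i : ℕ) : L ≃ₐ[K] L) : L →* L) := by
    have key : ∀ i j : ℕ, i ≤ j → j < n → (∀ x, (σ ^ i) x = (σ ^ j) x) → i = j := by
      intro i j hij hj hx
      obtain ⟨d, rfl⟩ := Nat.exists_eq_add_of_le hij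
      have hd : σ ^ d = 1 := by
        ext x
        have := hx x
        rw [pow_add, AlgEquiv.mul_apply] at this
        exact ((σ ^ i).injective this).symm
      have := Nat.eq_zero_of_dvd_of_lt (hσ d hd) (by omega)
      omega
    intro i j hij
    have hx : ∀ x, (σ ^ (i : ℕ)) x = (σ ^ (j : ℕ)) x := fun x => DFunLike.congr_fun hij x
    rcases le_total (i : ℕ) j with h | h
    · exact Fin.ext (key i j h j.2 hx)
    · exact (Fin.ext (key j i h i.2 fun x => (hx x).symm)).symm
  have hli := (linearIndependent_monoidHom L L).comp _ hinj
  rw [Fintype.linearIndependent_iff] at hli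
  have hz := hli (fun i => algebraMap K L (Q.coeff i)) (by
    ext x
    have hx := h x
    rw [aeval_eq_sum_range' hdeg, LinearMap.sum_apply,
      ← Fin.sum_univ_eq_sum_range (fun i => (Q.coeff i • σ.toLinearMap ^ i) x)] at hx
    rw [Finset.sum_apply, Pi.zero_apply, ← hx]
    refine Finset.sum_congr rfl fun i _ => ?_
    rw [LinearMap.smul_apply, toLinearMap_pow_apply, Pi.smul_apply, smul_eq_mul,
      Algebra.smul_def]
    rfl)
  apply hQ
  ext i
  rw [coeff_zero]
  by_cases hi : i < n
  · simpa using hz ⟨i, hi⟩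
  · exact coeff_eq_zero_of_natDegree_lt (by omega)

/-- A divisor `P` of `X ^ n - 1` of positive degree annihilates some nonzero element of `L`. -/
theorem exists_annihilated (σ : L ≃ₐ[K] L) {n : ℕ} (hn : 0 < n) (hσn : σ ^ n = 1)
    (hσ : ∀ k, σ ^ k = 1 → n ∣ k) {P : K[X]} (hP : 0 < P.natDegree) (hdvd : P ∣ X ^ n - 1) :
    ∃ w, w ≠ 0 ∧ aeval σ.toLinearMap P w = 0 := by
  obtain ⟨Q, hQ⟩ := hdvd
  have hne : (X ^ n - 1 : K[X]) ≠ 0 := by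
    have := X_pow_sub_C_ne_zero hn (1 : K)
    rwa [C_1] at this
  have hQ0 : Q ≠ 0 := by
    rintro rfl
    exact hne (by rw [hQ, mul_zero])
  have hP0 : P ≠ 0 := by
    rintro rfl
    simp at hP
  have hdeg : n = P.natDegree + Q.natDegree := by
    rw [← natDegree_mul hP0 hQ0, ← hQ]
    have := natDegree_X_pow_sub_C (n := n) (r := (1 : K))
    rw [C_1] at this
    exact this.symm
  obtain ⟨x, hx⟩ := exists_aeval_apply_ne_zero σ hσ hQ0 (by omega)
  refine ⟨_, hx, ?_⟩
  rw [← Module.End.mul_apply, ← map_mul, ← hQ]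
  simp only [map_sub, map_pow, aeval_X, map_one, LinearMap.sub_apply, Module.End.one_apply]
  rw [toLinearMap_pow_apply, hσn]
  simp

theorem exists_faithful_of_primitiveRoot
    (hcl : ∀ x : L, IsAlgebraic K x → x ∈ (algebraMap K L).range) (σ : L ≃ₐ[K] L) {n : ℕ}
    (hn : 2 ≤ n) (hσn : σ ^ n = 1) (hσ : ∀ k, σ ^ k = 1 → n ∣ k) {c : K}
    (hc : IsPrimitiveRoot c n) :
    ∃ E : IntermediateField K L, (∀ x ∈ E, σ x ∈ E) ∧
      (∀ k, (∀ x ∈ E, (σ ^ k) x = x) → n ∣ k) ∧ Algebra.trdeg K E = 1 := by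
  obtain ⟨w, hw0, hw⟩ := exists_annihilated σ (by omega) hσn hσ (P := X - C c) (by simp)
    (dvd_iff_isRoot.2 (by simp [hc.pow_eq_one]))
  have hw1 : σ w = algebraMap K L c * w := by
    simpa [sub_eq_zero, Algebra.smul_def] using hw
  have hpow : ∀ k : ℕ, (σ ^ k) w = algebraMap K L (c ^ k) * w := by
    intro k
    induction k with
    | zero => simp
    | succ k ih =>
      rw [pow_succ', AlgEquiv.mul_apply, ih, map_mul, AlgEquiv.commutes, hw1, pow_succ, map_mul,
        mul_assoc]
  have hfix : ∀ k, (σ ^ k) w = w → n ∣ k := by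
    intro k hk
    rw [hpow, mul_eq_right₀ hw0, map_eq_one_iff _ (algebraMap K L).injective] at hk
    exact hc.dvd_of_pow_eq_one k hk
  refine exists_faithful_of_generator hcl σ (fun h => ?_) ?_ hfix
  · have := Nat.le_of_dvd one_pos (hfix 1 (by simpa using h))
    omega
  · rw [hw1]
    exact mul_mem (IntermediateField.algebraMap_mem _ c) (mem_adjoin_simple_self K w)

/-- If `ζ ∉ K`, then `X² - s X + 1` is its minimal polynomial and divides `X ^ n - 1`. A vector `w`
killed by it gives `t = σ w / w`, on which `σ` acts by the Möbius matrix `(s, -1; 1, 0)` with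
eigenvalues `ζ` and `ζ⁻¹`. -/
theorem exists_faithful_of_add_inv
    (hcl : ∀ x : L, IsAlgebraic K x → x ∈ (algebraMap K L).range) (σ : L ≃ₐ[K] L) {n : ℕ}
    (hn : 2 ≤ n) (hodd : Odd n) (hσn : σ ^ n = 1) (hσ : ∀ k, σ ^ k = 1 → n ∣ k)
    {ζ : AlgebraicClosure K} (hζ : IsPrimitiveRoot ζ n)
    (hs : ζ + ζ⁻¹ ∈ (algebraMap K (AlgebraicClosure K)).range) :
    ∃ E : IntermediateField K L, (∀ x ∈ E, σ x ∈ E) ∧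
      (∀ k, (∀ x ∈ E, (σ ^ k) x = x) → n ∣ k) ∧ Algebra.trdeg K E = 1 := by
  by_cases hζK : ζ ∈ (algebraMap K (AlgebraicClosure K)).range
  · obtain ⟨c, rfl⟩ := hζK
    exact exists_faithful_of_primitiveRoot hcl σ hn hσn hσ
      (hζ.of_map_of_injective (algebraMap K (AlgebraicClosure K)).injective)
  obtain ⟨s, hs⟩ := hs
  have hζ0 : ζ ≠ 0 := hζ.ne_zero (by omega)
  have hprod : ζ * ζ⁻¹ = algebraMap K (AlgebraicClosure K) 1 := by
    rw [mul_inv_cancel₀ hζ0, map_one]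
  have hroot : ∀ c : K, c ^ 2 - s * c + 1 ≠ 0 := by
    intro c hc
    have h1 := congrArg (algebraMap K (AlgebraicClosure K)) hc
    simp only [map_add, map_sub, map_mul, map_pow, map_one, map_zero, hs] at h1
    have h2 : (algebraMap K (AlgebraicClosure K) c - ζ) *
        (algebraMap K (AlgebraicClosure K) c - ζ⁻¹) = 0 := by
      linear_combination h1 + mul_inv_cancel₀ hζ0
    rcases mul_eq_zero.1 h2 with h | h
    · exact hζK ⟨c, sub_eq_zero.1 h⟩
    · refine hζK ⟨c⁻¹, ?_⟩
      rw [map_inv₀, sub_eq_zero.1 h, inv_inv]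
  -- Here `n` must be odd: `ζ ^ (2 k) = 1` forces `n ∣ k`, so the Möbius transformation has order
  -- `n` and not `n / 2`.
  have h2k : ∀ k, ζ ^ k = ζ⁻¹ ^ k → n ∣ k := by
    intro k hk
    rw [inv_pow, ← mul_eq_one_iff_eq_inv₀ (pow_ne_zero _ hζ0), ← pow_add, ← two_mul] at hk
    exact (Nat.Coprime.dvd_mul_left (Nat.coprime_two_right.2 hodd)).1 (hζ.dvd_of_pow_eq_one _ hk)
  have hζne : ζ ≠ ζ⁻¹ := by
    intro h
    have := Nat.le_of_dvd one_pos (h2k 1 (by simpa using h))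
    omega
  have hquad : (X ^ 2 - C s * X + 1 : K[X]) ∣ X ^ n - 1 := by
    rw [← map_dvd_map' (algebraMap K (AlgebraicClosure K))]
    have h1 : (X ^ 2 - C s * X + 1 : K[X]).map (algebraMap K (AlgebraicClosure K)) =
        (X - C ζ) * (X - C ζ⁻¹) := by
      simp only [Polynomial.map_add, Polynomial.map_sub, Polynomial.map_mul, Polynomial.map_pow,
        map_X, map_C, Polynomial.map_one, hs, C_add]
      have h3 : (C ζ : (AlgebraicClosure K)[X]) * C ζ⁻¹ = 1 := by
        rw [← C_mul, hprod, map_one, C_1]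
      linear_combination -h3
    rw [h1]
    refine IsCoprime.mul_dvd (isCoprime_X_sub_C_of_isUnit_sub (sub_ne_zero.2 hζne).isUnit) ?_ ?_
    · exact dvd_iff_isRoot.2 (by simp [hζ.pow_eq_one])
    · exact dvd_iff_isRoot.2 (by simp [hζ.pow_eq_one])
  have hdeg : 0 < (X ^ 2 - C s * X + 1 : K[X]).natDegree := by
    have : (X ^ 2 - C s * X + 1 : K[X]) = C 1 * X ^ 2 + C (-s) * X + C 1 := by
      simp only [C_1, C_neg]
      ring
    rw [this, natDegree_quadratic one_ne_zero]
    norm_num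
  obtain ⟨w, hw0, hw⟩ := exists_annihilated σ (by omega) hσn hσ hdeg hquad
  have hw1 : σ (σ w) = algebraMap K L s * σ w - w := by
    have : σ (σ w) - algebraMap K L s * σ w + w = 0 := by
      simpa [Algebra.smul_def, pow_two, Module.algebraMap_end_apply] using hw
    linear_combination this
  have hσw : σ w ≠ 0 := (map_ne_zero σ).2 hw0
  have ht0 : σ w / w ≠ 0 := div_ne_zero hσw hw0
  have hσt : σ (σ w / w) = algebraMap K L s - (σ w / w)⁻¹ := by
    rw [map_div₀, hw1]
    field_simp
  have ht1 : σ (σ w / w) ≠ σ w / w := by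
    intro h
    rw [hσt] at h
    generalize σ w / w = t at h ht0
    have h1 : t ^ 2 - algebraMap K L s * t + 1 = 0 := by
      field_simp at h
      linear_combination -h
    have h2 : IsAlgebraic K t := by
      refine ⟨X ^ 2 - C s * X + 1, ?_, by simpa using h1⟩
      intro h0
      rw [h0] at hdeg
      simp at hdeg
    obtain ⟨c, rfl⟩ := hcl t h2
    apply hroot c
    apply (algebraMap K L).injective
    simpa using h1
  refine exists_faithful_of_generator hcl σ ht1 ?_ fun k hk => ?_
  · rw [hσt]
    exact sub_mem (IntermediateField.algebraMap_mem _ s) (inv_mem (mem_adjoin_simple_self K _))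
  · rw [pow_apply_eq_self_iff_lucas σ (σ w / w) (a := s) (b := -1) (c := 1) (d := 0)
      (by simpa using hw0) (by simp) (by
        rw [hσt]
        simp only [map_one, map_zero, map_neg]
        field_simp
        ring) ht1] at hk
    apply h2k
    have h1 := lucas_mul_sub (F := K) (T := s + 0) (D := s * 0 - (-1) * 1) (l := ζ) (m := ζ⁻¹)
      (by rw [add_zero, hs]) (by rw [hprod]; congr 1; ring) k
    rw [hk, map_zero, zero_mul] at h1
    exact sub_eq_zero.1 h1.symm

/-- `(σ - 1) ^ p = σ ^ p - 1 = 0`, while `(σ - 1) ^ (p - 1) ≠ 0` by Dedekind. The last two vectors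
`w, v` of a Jordan chain satisfy `σ w = w + v` and `σ v = v`, so `σ` translates `w / v` by `1`. -/
theorem exists_faithful_of_charP
    (hcl : ∀ x : L, IsAlgebraic K x → x ∈ (algebraMap K L).range) (p : ℕ) [Fact p.Prime]
    [CharP K p] (σ : L ≃ₐ[K] L) (hσp : σ ^ p = 1) (hσ : ∀ k, σ ^ k = 1 → p ∣ k) :
    ∃ E : IntermediateField K L, (∀ x ∈ E, σ x ∈ E) ∧
      (∀ k, (∀ x ∈ E, (σ ^ k) x = x) → p ∣ k) ∧ Algebra.trdeg K E = 1 := by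
  have hp := (Fact.out : p.Prime).two_le
  have : CharP L p := charP_of_injective_algebraMap (algebraMap K L).injective p
  obtain ⟨x, hx⟩ := exists_aeval_apply_ne_zero σ hσ (Q := (X - C 1) ^ (p - 1))
    (pow_ne_zero _ (X_sub_C_ne_zero 1)) (by rw [natDegree_pow, natDegree_X_sub_C]; omega)
  set v := aeval σ.toLinearMap ((X - C 1 : K[X]) ^ (p - 1)) x with hv
  set w := aeval σ.toLinearMap ((X - C 1 : K[X]) ^ (p - 2)) x with hw
  have hstep : ∀ y, aeval σ.toLinearMap (X - C 1 : K[X]) y = σ y - y := by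
    intro y
    simp
  have hσw : σ w = w + v := by
    have : v = σ w - w := by
      rw [← hstep, hw, ← Module.End.mul_apply, ← map_mul, ← pow_succ', hv]
      congr 4
      omega
    rw [this]
    ring
  have hσv : σ v = v := by
    rw [← sub_eq_zero, ← hstep, hv, ← Module.End.mul_apply, ← map_mul, ← pow_succ',
      show p - 1 + 1 = p by omega, sub_pow_char, ← C_pow, one_pow]
    simp only [map_sub, map_pow, aeval_X, map_one, LinearMap.sub_apply, Module.End.one_apply]
    rw [toLinearMap_pow_apply, hσp]
    simp
  have hσt : σ (w / v) = w / v + 1 := by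
    rw [map_div₀, hσw, hσv, add_div, div_self hx]
  have hpow : ∀ k : ℕ, (σ ^ k) (w / v) = w / v + k := by
    intro k
    induction k with
    | zero => simp
    | succ k ih =>
      rw [pow_succ', AlgEquiv.mul_apply, ih, map_add, map_natCast, hσt]
      push_cast
      ring
  refine exists_faithful_of_generator hcl σ (t := w / v) ?_ ?_ fun k hk => ?_
  · rw [hσt]
    simp
  · rw [hσt]
    exact add_mem (mem_adjoin_simple_self K _) (one_mem _)
  · rw [hpow, add_eq_left] at hk
    exact (CharP.cast_eq_zero_iff L p k).1 hk

end Construction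

/-! ### Coefficients of Laurent series -/

section HahnSeriesLemmas

variable {R S : Type*} [CommRing R] [CommRing S]

theorem ofPowerSeries_coeff_of_neg (f : PowerSeries R) {i : ℤ} (hi : i < 0) :
    (HahnSeries.ofPowerSeries ℤ R f).coeff i = 0 := by
  rw [HahnSeries.ofPowerSeries_apply]
  apply HahnSeries.embDomain_of_notMem_range
  rintro ⟨k, hk⟩
  have : (k : ℤ) = i := hk
  omega

/-- A ring homomorphism applied to all the coefficients of a Hahn series. -/
noncomputable def hahnMap (s : R →+* S) : HahnSeries ℤ R →+* HahnSeries ℤ S where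
  toFun x := x.map s
  map_zero' := by ext; simp
  map_one' := HahnSeries.map_one s.toMonoidWithZeroHom
  map_add' x y := by ext; simp
  map_mul' x y := HahnSeries.map_mul s.toNonUnitalRingHom

theorem hahnMap_coeff (s : R →+* S) (x : HahnSeries ℤ R) (i : ℤ) :
    (hahnMap s x).coeff i = s (x.coeff i) := HahnSeries.map_coeff x s i

end HahnSeriesLemmas

/-! ### The valuation of an involution and the case of even `n` -/

section Grading

open Polynomial

variable {K V : Type*} [Field K] [AddCommGroup V] [Module K V]

theorem symMap_ι (S : Module.Dual K V →ₗ[K] Module.Dual K V) (f : Module.Dual K V) :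
    symMap S (SymmetricAlgebra.ι K _ f) = SymmetricAlgebra.ι K _ (S f) := by
  simp [symMap]

/-- The homomorphism `K[V] → K[V][X]` that is the identity on the `1`-eigenspace of the linear
involution `T` and multiplies the `-1`-eigenspace by `X`. -/
noncomputable def gradingHom (T : Module.Dual K V →ₗ[K] Module.Dual K V) :
    CoordRing K V →ₐ[K] (CoordRing K V)[X] :=
  SymmetricAlgebra.lift
    (((IsScalarTower.toAlgHom K (CoordRing K V) (CoordRing K V)[X]).toLinearMap ∘ₗ
        SymmetricAlgebra.ι K _ ∘ₗ ((2⁻¹ : K) • (1 + T))) +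
      (LinearMap.mulRight K (X : (CoordRing K V)[X]) ∘ₗ
        (IsScalarTower.toAlgHom K (CoordRing K V) (CoordRing K V)[X]).toLinearMap ∘ₗ
        SymmetricAlgebra.ι K _ ∘ₗ ((2⁻¹ : K) • (1 - T))))

theorem gradingHom_ι (T : Module.Dual K V →ₗ[K] Module.Dual K V) (f : Module.Dual K V) :
    gradingHom T (SymmetricAlgebra.ι K _ f) =
      C (SymmetricAlgebra.ι K _ ((2⁻¹ : K) • (f + T f))) +
      C (SymmetricAlgebra.ι K _ ((2⁻¹ : K) • (f - T f))) * X := by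
  rw [gradingHom, SymmetricAlgebra.lift_ι_apply]
  rfl

variable {T : Module.Dual K V →ₗ[K] Module.Dual K V}

theorem gradingHom_injective (h2 : (2 : K) ≠ 0) : Function.Injective (gradingHom T) := by
  -- Setting `X = 1` adds the two eigencomponents together again, a left inverse.
  have h : ((Polynomial.aeval (1 : CoordRing K V)).restrictScalars K).comp (gradingHom T) =
      AlgHom.id K _ := by
    apply SymmetricAlgebra.algHom_ext
    ext1 f
    change Polynomial.aeval (1 : CoordRing K V) (gradingHom T (SymmetricAlgebra.ι K _ f)) =
      SymmetricAlgebra.ι K _ f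
    rw [gradingHom_ι, map_add, map_mul, aeval_C, aeval_C, aeval_X, mul_one,
      Algebra.algebraMap_self, RingHom.id_apply, RingHom.id_apply, ← map_add, ← smul_add,
      add_add_sub_cancel, ← two_smul K f, smul_smul, inv_mul_cancel₀ h2, one_smul]
  exact Function.LeftInverse.injective (fun x => DFunLike.congr_fun h x)

theorem gradingHom_symMap {S : Module.Dual K V →ₗ[K] Module.Dual K V} (hST : S * T = T * S)
    (x : CoordRing K V) :
    gradingHom T (symMap S x) = (gradingHom T x).map (symMap S).toRingHom := by
  have h : (gradingHom T).comp (symMap S) = (mapAlgHom (symMap S)).comp (gradingHom T) := by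
    apply SymmetricAlgebra.algHom_ext
    ext1 f
    have hf : T (S f) = S (T f) := (DFunLike.congr_fun hST f).symm
    change gradingHom T (symMap S (SymmetricAlgebra.ι K _ f)) =
      (gradingHom T (SymmetricAlgebra.ι K _ f)).map (symMap S).toRingHom
    simp only [symMap_ι, gradingHom_ι, Polynomial.map_add, Polynomial.map_mul, map_C, map_X,
      AlgHom.toRingHom_eq_coe, RingHom.coe_coe, hf, map_smul, map_sub, map_add]
  exact DFunLike.congr_fun h x

theorem map_symMap_gradingHom (hT : T * T = 1) (x : CoordRing K V) :
    (gradingHom T x).map (symMap T).toRingHom = (gradingHom T x).comp (C (-1) * X) := by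
  have h : (mapAlgHom (symMap T)).comp (gradingHom T) =
      ((Polynomial.aeval (C (-1) * X : (CoordRing K V)[X])).restrictScalars K).comp
        (gradingHom T) := by
    apply SymmetricAlgebra.algHom_ext
    ext1 f
    have hf : T (T f) = f := DFunLike.congr_fun hT f
    change (gradingHom T (SymmetricAlgebra.ι K _ f)).map (symMap T).toRingHom =
      Polynomial.aeval (C (-1) * X : (CoordRing K V)[X]) (gradingHom T (SymmetricAlgebra.ι K _ f))
    simp only [symMap_ι, gradingHom_ι, Polynomial.map_add, Polynomial.map_mul, map_C, map_X,
      AlgHom.toRingHom_eq_coe, RingHom.coe_coe, hf, map_smul, map_sub, map_add, map_mul,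
      aeval_C, aeval_X, C_neg, C_1, algebraMap_eq]
    simp only [smul_sub, smul_add, map_sub, map_add]
    ring
  exact DFunLike.congr_fun h x

theorem symMap_coeff_gradingHom (hT : T * T = 1) (x : CoordRing K V) (i : ℕ) :
    symMap T ((gradingHom T x).coeff i) = (-1) ^ i * (gradingHom T x).coeff i := by
  have h := congrArg (fun P => P.coeff i) (map_symMap_gradingHom hT x)
  simp only [coeff_map, comp_C_mul_X_coeff] at h
  rw [mul_comm]
  exact h

variable {L : Type*} [Field L] [Algebra (CoordRing K V) L]

variable (T L) in
/-- The composition of `gradingHom` with the inclusion in the Laurent series over `L`. -/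
noncomputable def laurentHom : CoordRing K V →+* HahnSeries ℤ (L) :=
  ((HahnSeries.ofPowerSeries ℤ (L)).comp coeToPowerSeries.ringHom).comp
    ((mapRingHom (algebraMap (CoordRing K V) (L))).comp (gradingHom T).toRingHom)

theorem laurentHom_coeff (x : CoordRing K V) (i : ℕ) :
    (laurentHom T L x).coeff i = algebraMap _ L ((gradingHom T x).coeff i) := by
  refine (HahnSeries.ofPowerSeries_apply_coeff _ i).trans ?_
  refine (Polynomial.coeff_coe _ i).trans ?_
  exact coeff_map _ i

theorem laurentHom_coeff_of_neg (x : CoordRing K V) {i : ℤ} (hi : i < 0) :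
    (laurentHom T L x).coeff i = 0 := ofPowerSeries_coeff_of_neg _ hi

theorem pow_algebraMap_eq [Algebra K L] {S : Module.Dual K V →ₗ[K] Module.Dual K V} {σ : L ≃ₐ[K] L}
    (hσ : ∀ x, σ (algebraMap (CoordRing K V) L x) = algebraMap _ L (symMap S x)) (k : ℕ)
    (x : CoordRing K V) :
    (σ ^ k) (algebraMap _ L x) = algebraMap _ L (symMap (S ^ k) x) := by
  induction k generalizing x with
  | zero =>
    rw [pow_zero, pow_zero, symMap_one]
    rfl
  | succ k ih =>
    rw [pow_succ', pow_succ', symMap_mul, AlgEquiv.mul_apply, ih, hσ]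
    rfl

variable [IsFractionRing (CoordRing K V) L]

theorem laurentHom_injective (h2 : (2 : K) ≠ 0) : Function.Injective (laurentHom T L) := by
  intro x y hxy
  apply gradingHom_injective (T := T) h2
  ext i
  apply IsFractionRing.injective (CoordRing K V) (L)
  rw [← laurentHom_coeff, ← laurentHom_coeff, hxy]

/-- The embedding of `L` in the Laurent series over `L` attached to a linear involution. -/
noncomputable def laurentEmbedding (T : Module.Dual K V →ₗ[K] Module.Dual K V)
    (L : Type*) [Field L] [Algebra (CoordRing K V) L] [IsFractionRing (CoordRing K V) L]
    (h2 : (2 : K) ≠ 0) : L →+* HahnSeries ℤ (L) :=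
  IsFractionRing.lift (laurentHom_injective (T := T) (L := L) h2)

theorem laurentEmbedding_algebraMap (h2 : (2 : K) ≠ 0) (x : CoordRing K V) :
    laurentEmbedding T L h2 (algebraMap _ L x) = laurentHom T L x :=
  IsFractionRing.lift_algebraMap _ _

theorem laurentEmbedding_equivariant (h2 : (2 : K) ≠ 0)
    {S : Module.Dual K V →ₗ[K] Module.Dual K V} (hST : S * T = T * S)
    (s : L →+* L)
    (hs : ∀ x, s (algebraMap (CoordRing K V) _ x) = algebraMap _ _ (symMap S x))
    (e : L) (i : ℤ) :
    (laurentEmbedding T L h2 (s e)).coeff i = s ((laurentEmbedding T L h2 e).coeff i) := by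
  rw [← hahnMap_coeff s]
  congr 1
  have h : (laurentEmbedding T L h2).comp s = (hahnMap s).comp (laurentEmbedding T L h2) := by
    apply IsFractionRing.ringHom_ext (A := CoordRing K V)
    intro x
    rw [RingHom.comp_apply, RingHom.comp_apply, hs, laurentEmbedding_algebraMap,
      laurentEmbedding_algebraMap]
    ext i
    rw [hahnMap_coeff]
    rcases lt_or_ge i 0 with hi | hi
    · rw [laurentHom_coeff_of_neg _ hi, laurentHom_coeff_of_neg _ hi, map_zero]
    · lift i to ℕ using hi
      rw [laurentHom_coeff, laurentHom_coeff, hs, gradingHom_symMap hST, coeff_map]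
      rfl
  exact congrArg (fun f => f e) (congrArg DFunLike.coe h)

/-- The leading coefficient of a nonzero `a ∈ K[V]` of order `d` is multiplied by `(-1) ^ d` under
`T`. In a nonzero quotient of order zero the two orders agree and the signs cancel. -/
theorem laurentEmbedding_leading_invariant (h2 : (2 : K) ≠ 0) (hT : T * T = 1)
    (s : L →+* L)
    (hs : ∀ x, s (algebraMap (CoordRing K V) _ x) = algebraMap _ _ (symMap T x))
    {e : L} (he : (laurentEmbedding T L h2 e).order = 0) :
    s (leadHom (laurentEmbedding T L h2) e) = leadHom (laurentEmbedding T L h2) e := by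
  by_cases he0 : e = 0
  · rw [he0, map_zero, map_zero]
  have key : ∀ a : CoordRing K V, a ≠ 0 →
      s (leadHom (laurentEmbedding T L h2) (algebraMap _ L a)) =
        (-1) ^ (laurentHom T L a).order * leadHom (laurentEmbedding T L h2) (algebraMap _ L a) := by
    intro a ha
    have h1 : leadHom (laurentEmbedding T L h2) (algebraMap _ L a) =
        (laurentHom T L a).coeff (laurentHom T L a).order := by
      rw [← HahnSeries.leadingCoeff_eq, ← laurentEmbedding_algebraMap h2]
      rfl
    have hne : laurentHom T L a ≠ 0 := by
      rw [Ne, map_eq_zero_iff _ (laurentHom_injective h2)]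
      exact ha
    have h0 : 0 ≤ (laurentHom T L a).order := by
      by_contra! hlt
      exact hne (HahnSeries.coeff_order_eq_zero.1 (laurentHom_coeff_of_neg a hlt))
    rw [h1]
    generalize (laurentHom T L a).order = d at h0
    lift d to ℕ using h0
    rw [laurentHom_coeff, hs, symMap_coeff_gradingHom hT, zpow_natCast, map_mul, map_pow, map_neg,
      map_one]
  obtain ⟨a, b, hb, rfl⟩ := IsFractionRing.div_surjective (A := CoordRing K V) e
  have hb0 : b ≠ 0 := nonZeroDivisors.ne_zero hb
  have ha0 : a ≠ 0 := by
    rintro rfl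
    simp at he0
  have hA := laurentHom_injective (T := T) (L := L) h2
  have ha' : laurentHom T L a ≠ 0 := (map_ne_zero_iff _ hA).2 ha0
  have hb' : laurentHom T L b ≠ 0 := (map_ne_zero_iff _ hA).2 hb0
  have hord : (laurentHom T L a).order = (laurentHom T L b).order := by
    rw [map_div₀, div_eq_mul_inv, laurentEmbedding_algebraMap, laurentEmbedding_algebraMap,
      HahnSeries.order_mul ha' (inv_ne_zero hb'), order_inv hb'] at he
    omega
  rw [map_div₀, map_div₀, key a ha0, key b hb0, hord, mul_div_mul_left]
  exact zpow_ne_zero _ (neg_ne_zero.2 one_ne_zero)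

variable [Algebra K L] [IsScalarTower K (CoordRing K V) L]

theorem laurentEmbedding_constant (h2 : (2 : K) ≠ 0) (c : K) :
    laurentEmbedding T L h2 (algebraMap K L c) = HahnSeries.C (algebraMap K _ c) := by
  rw [IsScalarTower.algebraMap_apply K (CoordRing K V) (L),
    laurentEmbedding_algebraMap, ← HahnSeries.ofPowerSeries_C]
  change HahnSeries.ofPowerSeries ℤ _ (coeToPowerSeries.ringHom (Polynomial.map _
    (gradingHom T (algebraMap K _ c)))) = _
  rw [AlgHom.commutes]
  congr 1
  rw [IsScalarTower.algebraMap_apply K (CoordRing K V) (CoordRing K V)[X]]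
  simp [Polynomial.algebraMap_eq]

theorem exists_isPrimitiveRoot_of_even
    (hcl : ∀ x : L, IsAlgebraic K x → x ∈ (algebraMap K L).range)
    {S : Module.Dual K V →ₗ[K] Module.Dual K V} {σ : L ≃ₐ[K] L}
    (hσ : ∀ x, σ (algebraMap (CoordRing K V) L x) = algebraMap _ L (symMap S x)) {n : ℕ}
    (hn : Even n) (hnK : (n : K) ≠ 0) (hSn : S ^ n = 1) (hσn : σ ^ n = 1)
    {E : IntermediateField K L} (hE : Algebra.trdeg K E = 1) (hσE : ∀ x ∈ E, σ x ∈ E)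
    (hfaith : ∀ k, (∀ x ∈ E, (σ ^ k) x = x) → n ∣ k) : ∃ c : K, IsPrimitiveRoot c n := by
  obtain ⟨m, rfl⟩ := hn
  have h2 : (2 : K) ≠ 0 := by
    intro h
    apply hnK
    rw [← two_mul, Nat.cast_mul, Nat.cast_two, h, zero_mul]
  have hm : m ≠ 0 := by
    rintro rfl
    simp at hnK
  have hT : S ^ m * S ^ m = 1 := by rw [← pow_add, hSn]
  have hST : S * S ^ m = S ^ m * S := by rw [← pow_succ, ← pow_succ']
  have hequiv := laurentEmbedding_equivariant h2 hST (σ : L →+* L) hσ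
  refine exists_isPrimitiveRoot (laurentEmbedding (S ^ m) L h2) hcl
    (laurentEmbedding_constant h2) hE ?_ σ hequiv hσE hnK hσn hfaith
  -- Suppose every element of `E` has order zero. Some `y = σ ^ m x - x` in `E` is nonzero and
  -- negated by `σ ^ m`, whereas its leading coefficient is `σ ^ m`-invariant; this contradicts `2 ≠
  -- 0`.
  by_contra! hv
  have hpE := fun k => pow_apply_mem hσE k
  obtain ⟨x, hx, hxm⟩ : ∃ x ∈ E, (σ ^ m) x ≠ x := by
    by_contra! h
    have := Nat.le_of_dvd (Nat.pos_of_ne_zero hm) (hfaith m h)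
    omega
  have hτ := pow_algebraMap_eq hσ m
  have hTT : S ^ m * S ^ m = S ^ m * S ^ m := rfl
  have h1 := laurentEmbedding_leading_invariant h2 hT ((σ ^ m : L ≃ₐ[K] L) : L →+* L) hτ
    (hv ((σ ^ m) x - x) (sub_mem (hpE m x hx) hx))
  have h3 := (order_eq_and_leadingCoeff_eq (σ := (σ ^ m).toRingEquiv)
    (laurentEmbedding_equivariant h2 hTT ((σ ^ m : L ≃ₐ[K] L) : L →+* L) hτ
      ((σ ^ m) x - x))).2
  have h4 : (σ ^ m) ((σ ^ m) x - x) = -((σ ^ m) x - x) := by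
    rw [map_sub, ← AlgEquiv.mul_apply, ← pow_add, hσn, neg_sub]
    rfl
  have h5 : leadHom (laurentEmbedding (S ^ m) L h2) (-((σ ^ m) x - x)) =
      leadHom (laurentEmbedding (S ^ m) L h2) ((σ ^ m) x - x) := by
    rw [← h4]
    exact h3.trans h1
  have h6 : leadHom (laurentEmbedding (S ^ m) L h2) (-((σ ^ m) x - x)) =
      -leadHom (laurentEmbedding (S ^ m) L h2) ((σ ^ m) x - x) := by
    change (laurentEmbedding (S ^ m) L h2 (-((σ ^ m) x - x))).leadingCoeff = _
    rw [map_neg, HahnSeries.leadingCoeff_neg]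
    rfl
  have h7 : leadHom (laurentEmbedding (S ^ m) L h2) ((σ ^ m) x - x) ≠ 0 :=
    (_root_.map_ne_zero _).2 (sub_ne_zero.2 hxm)
  have h8 : (2 : L) * leadHom (laurentEmbedding (S ^ m) L h2) ((σ ^ m) x - x) = 0 := by
    linear_combination h6 - h5
  have h9 : (2 : L) ≠ 0 := by
    rw [← map_ofNat (algebraMap K L) 2]
    exact (_root_.map_ne_zero _).2 h2
  exact (mul_ne_zero h9 h7) h8

end Grading

/-! ### Restriction to a stable subfield and the lower bound -/

section Restriction

variable {K L : Type*} [Field K] [Field L] [Algebra K L]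

theorem exists_restriction {σ : L ≃ₐ[K] L} {n : ℕ} (hn : n ≠ 0) (hσn : σ ^ n = 1)
    {E : IntermediateField K L} (hσE : ∀ x ∈ E, σ x ∈ E)
    (hfaith : ∀ k, (∀ x ∈ E, (σ ^ k) x = x) → n ∣ k) :
    ∃ τ : E ≃ₐ[K] E, ∀ k, τ ^ k = 1 ↔ n ∣ k := by
  have hpE := fun k => pow_apply_mem hσE k
  let f : E →ₐ[K] E := (σ.toAlgHom.comp E.val).codRestrict E.toSubalgebra fun x => hσE x x.2
  have hf : ∀ x : E, (f x : L) = σ x := fun x => rfl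
  have hsurj : Function.Surjective f := by
    intro y
    refine ⟨⟨(σ ^ (n - 1)) y, hpE _ _ y.2⟩, Subtype.ext ?_⟩
    rw [hf]
    change σ ((σ ^ (n - 1)) y) = y
    rw [← AlgEquiv.mul_apply, ← pow_succ', Nat.sub_add_cancel (Nat.pos_of_ne_zero hn), hσn]
    rfl
  let τ : E ≃ₐ[K] E := AlgEquiv.ofBijective f ⟨f.toRingHom.injective, hsurj⟩
  have hτ : ∀ k (x : E), ((τ ^ k) x : L) = (σ ^ k) x := by
    intro k
    induction k with
    | zero => exact fun x => rfl
    | succ k ih =>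
      intro x
      rw [pow_succ', pow_succ', AlgEquiv.mul_apply, AlgEquiv.mul_apply, ← ih]
      exact hf _
  refine ⟨τ, fun k => ⟨fun h => hfaith k fun x hx => ?_, ?_⟩⟩
  · rw [← hτ k ⟨x, hx⟩, h]
    rfl
  · rintro ⟨d, rfl⟩
    refine AlgEquiv.ext fun x => Subtype.ext ?_
    rw [hτ, pow_mul, hσn, one_pow]
    rfl

theorem trdeg_ne_zero_of_faithful
    (hcl : ∀ x : L, IsAlgebraic K x → x ∈ (algebraMap K L).range) (σ : L ≃ₐ[K] L) {n : ℕ}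
    (hn : 2 ≤ n) {E : IntermediateField K L}
    (hfaith : ∀ k, (∀ x ∈ E, (σ ^ k) x = x) → n ∣ k) : Algebra.trdeg K E ≠ 0 := by
  intro h
  have halg : Algebra.IsAlgebraic K E := by
    by_contra hE
    exact (trdeg_ne_zero_iff.2 (Algebra.transcendental_iff_not_isAlgebraic.2 hE)) h
  have h1 := hfaith 1 fun x hx => by
    obtain ⟨c, rfl⟩ := hcl x ((halg.isAlgebraic (⟨x, hx⟩ : E)).algHom E.val)
    exact AlgEquiv.commutes _ _
  have := Nat.le_of_dvd one_pos h1
  omega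

end Restriction

/-! ### The function field `K(V)` and its group action -/

section FunctionField

variable {K V : Type*} [Field K] [AddCommGroup V] [Module K V]

theorem ι_injective : Function.Injective (SymmetricAlgebra.ι K V) := by
  intro x y hxy
  rw [← sub_eq_zero, ← Module.forall_dual_apply_eq_zero_iff K]
  -- A linear form extends to an algebra homomorphism to `K`, and linear forms separate points.
  intro φ
  have := congrArg (SymmetricAlgebra.lift φ) hxy
  rw [SymmetricAlgebra.lift_ι_apply, SymmetricAlgebra.lift_ι_apply] at this
  rw [map_sub, this, sub_self]

variable (K V) in
/-- The function field of `V` as a field of rational functions. -/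
noncomputable def funFieldEquiv [Module.Finite K V] :
    FunField K V ≃ₐ[K] MvRatFunc K (Module.finrank K (Module.Dual K V)) :=
  IsFractionRing.fieldEquivOfAlgEquiv K _ _
    (SymmetricAlgebra.equivMvPolynomial (Module.finBasis K (Module.Dual K V)))

theorem funField_mem_range_of_isAlgebraic [Module.Finite K V] {x : FunField K V}
    (hx : IsAlgebraic K x) : x ∈ (algebraMap K (FunField K V)).range := by
  obtain ⟨c, hc⟩ := mvRatFunc_mem_range_of_isAlgebraic K _
    (hx.algHom (funFieldEquiv K V).toAlgHom)
  refine ⟨c, (funFieldEquiv K V).injective ?_⟩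
  rw [AlgEquiv.commutes, hc]
  rfl

variable {G : Type*} [Group G] (ρ : Representation K G V)

theorem funFieldAction_algebraMap (g : G) (x : CoordRing K V) :
    funFieldAction ρ g (algebraMap _ (FunField K V) x) =
      algebraMap _ (FunField K V) (symMap (ρ.dual g) x) :=
  IsFractionRing.fieldEquivOfAlgEquiv_algebraMap K (FunField K V) (FunField K V)
    (coordAction ρ g) x

variable {ρ}

theorem funFieldAction_injective (hρ : Function.Injective ρ) :
    Function.Injective (funFieldAction ρ) := by
  rw [injective_iff_map_eq_one]
  intro g hg
  have h1 : ∀ f : Module.Dual K V, ρ.dual g f = f := by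
    intro f
    apply ι_injective (K := K)
    apply IsFractionRing.injective (CoordRing K V) (FunField K V)
    rw [← symMap_ι, ← funFieldAction_algebraMap, hg]
    rfl
  have h2 : ρ g⁻¹ = 1 := by
    ext v
    change ρ g⁻¹ v = v
    rw [← sub_eq_zero, ← Module.forall_dual_apply_eq_zero_iff K]
    intro f
    have := congrArg (fun φ => φ v) (h1 f)
    rw [map_sub, sub_eq_zero]
    exact this
  have h3 : g⁻¹ = 1 := hρ (h2.trans (map_one ρ).symm)
  exact inv_eq_one.1 h3

end FunctionField

/-! ### Essential dimension one in terms of a generator -/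

section Cyclic

variable {K V : Type*} [Field K] [AddCommGroup V] [Module K V] {n : ℕ}
  (ρ : Representation K (Multiplicative (ZMod n)) V)

/-- The automorphism of the function field given by the standard generator of `ℤ/n`. -/
noncomputable def generatorAction : FunField K V ≃ₐ[K] FunField K V :=
  funFieldAction ρ (Multiplicative.ofAdd 1)

theorem ofAdd_one_pow (k : ℕ) :
    (Multiplicative.ofAdd (1 : ZMod n)) ^ k = Multiplicative.ofAdd (k : ZMod n) := by
  rw [← ofAdd_nsmul, nsmul_one]

theorem generatorAction_pow (k : ℕ) :
    generatorAction ρ ^ k = funFieldAction ρ (Multiplicative.ofAdd (k : ZMod n)) := by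
  rw [generatorAction, ← map_pow, ofAdd_one_pow]

theorem ofAdd_one_pow_card : (Multiplicative.ofAdd (1 : ZMod n)) ^ n = 1 := by
  rw [ofAdd_one_pow, ZMod.natCast_self, ofAdd_zero]

theorem generatorAction_pow_card : generatorAction ρ ^ n = 1 := by
  rw [generatorAction, ← map_pow, ofAdd_one_pow_card, map_one]

variable {ρ}

theorem dvd_of_generatorAction_pow (hρ : Function.Injective ρ) {k : ℕ}
    (hk : generatorAction ρ ^ k = 1) : n ∣ k := by
  rw [generatorAction_pow] at hk
  have h := funFieldAction_injective hρ (hk.trans (map_one _).symm)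
  exact (ZMod.natCast_eq_zero_iff k n).1 (Multiplicative.ofAdd.injective h)

theorem isFaithfulSubfield_iff [NeZero n] {E : IntermediateField K (FunField K V)} :
    IsFaithfulSubfield ρ E ↔ (∀ x ∈ E, generatorAction ρ x ∈ E) ∧
      ∀ k, (∀ x ∈ E, (generatorAction ρ ^ k) x = x) → n ∣ k := by
  have hg : ∀ g : Multiplicative (ZMod n), ∃ k : ℕ, g = Multiplicative.ofAdd (k : ZMod n) :=
    fun g => ⟨g.toAdd.val, by rw [ZMod.natCast_zmod_val, ofAdd_toAdd]⟩
  constructor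
  · refine fun h => ⟨h.stable _, fun k hk => ?_⟩
    rw [generatorAction_pow] at hk
    exact (ZMod.natCast_eq_zero_iff k n).1 (Multiplicative.ofAdd.injective (h.faithful _ hk))
  · rintro ⟨h1, h2⟩
    refine ⟨fun g => ?_, fun g h => ?_⟩
    · obtain ⟨k, rfl⟩ := hg g
      rw [← generatorAction_pow]
      exact pow_apply_mem h1 k
    · obtain ⟨k, rfl⟩ := hg g
      rw [← generatorAction_pow] at h
      rw [(ZMod.natCast_eq_zero_iff k n).2 (h2 k h), ofAdd_zero]

theorem essDim_eq_one_iff [Module.Finite K V] (hn : 2 ≤ n) :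
    essDim ρ = 1 ↔ ∃ E : IntermediateField K (FunField K V),
      (∀ x ∈ E, generatorAction ρ x ∈ E) ∧
      (∀ k, (∀ x ∈ E, (generatorAction ρ ^ k) x = x) → n ∣ k) ∧ Algebra.trdeg K E = 1 := by
  have : NeZero n := ⟨by omega⟩
  constructor
  · intro h
    -- The infimum of the empty set is `0`, so the value `1` already guarantees that the minimum is
    -- attained.
    have h1 := Nat.sInf_mem (Nat.nonempty_of_pos_sInf (h.symm ▸ one_pos : 0 < essDim ρ))
    obtain ⟨E, hE, hE1⟩ := h1
    obtain ⟨h2, h3⟩ := isFaithfulSubfield_iff.1 hE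
    refine ⟨E, h2, h3, hE1.trans ?_⟩
    change ((essDim ρ : ℕ) : Cardinal) = 1
    rw [h, Nat.cast_one]
  · rintro ⟨E, h2, h3, hE1⟩
    refine le_antisymm (Nat.sInf_le ⟨E, isFaithfulSubfield_iff.2 ⟨h2, h3⟩, by
      rw [hE1, Nat.cast_one]⟩) ?_
    refine le_csInf ⟨1, E, isFaithfulSubfield_iff.2 ⟨h2, h3⟩, by rw [hE1, Nat.cast_one]⟩ ?_
    rintro d ⟨F, hF, hd⟩
    rw [Nat.one_le_iff_ne_zero]
    rintro rfl
    have h0 := trdeg_ne_zero_of_faithful (L := FunField K V)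
      (fun x => funField_mem_range_of_isAlgebraic (x := x)) (generatorAction ρ) hn
      (isFaithfulSubfield_iff.1 hF).2
    exact h0 (hd.trans Nat.cast_zero)

end Cyclic

end EssDim

/-- `G = ℤ/nℤ` (written multiplicatively) with `n ≥ 2`, over a field `K` of characteristic `p`
(zero or prime), and `ed_K(G)` computed from any faithful finite-dimensional representation `ρ`.
`ζ` is any primitive `n`-th root of unity in an algebraic closure of `K`. -/
theorem theorem1p3 {K : Type*} [Field K] (p : ℕ) [CharP K p] (n : ℕ) (hn : 2 ≤ n)
    {V : Type*} [AddCommGroup V] [Module K V] [Module.Finite K V]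
    (ρ : Representation K (Multiplicative (ZMod n)) V) (hρ : Function.Injective ρ) :
    (¬ p ∣ n → ∀ ζ : AlgebraicClosure K, IsPrimitiveRoot ζ n →
      (Odd n → (EssDim.essDim ρ = 1 ↔
        ζ + ζ⁻¹ ∈ (algebraMap K (AlgebraicClosure K)).range)) ∧
      (Even n → (EssDim.essDim ρ = 1 ↔
        ζ ∈ (algebraMap K (AlgebraicClosure K)).range))) ∧
    (0 < p → p ∣ n → (EssDim.essDim ρ = 1 ↔ n = p)) := by
  have hσn := EssDim.generatorAction_pow_card ρ
  have hσ := fun k => EssDim.dvd_of_generatorAction_pow hρ (k := k)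
  have hcl : ∀ x : EssDim.FunField K V, IsAlgebraic K x →
      x ∈ (algebraMap K (EssDim.FunField K V)).range :=
    fun _ => EssDim.funField_mem_range_of_isAlgebraic
  have hord (h : EssDim.essDim ρ = 1) : (¬ p ∣ n → ∀ ζ : AlgebraicClosure K,
      IsPrimitiveRoot ζ n → ζ + ζ⁻¹ ∈ (algebraMap K (AlgebraicClosure K)).range) ∧
      (0 < p → p ∣ n → n = p) := by
    obtain ⟨E, hσE, hfaith, hE⟩ := (EssDim.essDim_eq_one_iff hn).1 h
    obtain ⟨τ, hτ⟩ := EssDim.exists_restriction (by omega) hσn hσE hfaith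
    exact EssDim.order_of_embedding p hn hE τ hτ
      ((EssDim.funFieldEquiv K V).toAlgHom.comp E.val)
  refine ⟨fun hpn ζ hζ => ⟨fun hodd => ⟨fun h => (hord h).1 hpn ζ hζ, fun h => ?_⟩,
    fun heven => ⟨fun h => ?_, ?_⟩⟩, fun hp hpn => ⟨fun h => (hord h).2 hp hpn, ?_⟩⟩
  · exact (EssDim.essDim_eq_one_iff hn).2
      (EssDim.exists_faithful_of_add_inv hcl _ hn hodd hσn hσ hζ h)
  · obtain ⟨E, hσE, hfaith, hE⟩ := (EssDim.essDim_eq_one_iff hn).1 h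
    have hnK : (n : K) ≠ 0 := fun h0 => hpn ((CharP.cast_eq_zero_iff K p n).1 h0)
    have hSn : ρ.dual (Multiplicative.ofAdd 1) ^ n = 1 := by
      rw [← map_pow, EssDim.ofAdd_one_pow_card, map_one]
    obtain ⟨c, hc⟩ := EssDim.exists_isPrimitiveRoot_of_even hcl
      (EssDim.funFieldAction_algebraMap ρ (Multiplicative.ofAdd 1)) heven hnK hSn hσn hE hσE
      hfaith
    have hc' := hc.map_of_injective (algebraMap K (AlgebraicClosure K)).injective
    have : NeZero n := ⟨by omega⟩
    -- The given `ζ` is a power of the primitive root found in `K`.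
    obtain ⟨i, -, rfl⟩ := hc'.eq_pow_of_pow_eq_one hζ.pow_eq_one
    exact ⟨c ^ i, map_pow _ _ _⟩
  · rintro ⟨c, rfl⟩
    exact (EssDim.essDim_eq_one_iff hn).2 (EssDim.exists_faithful_of_primitiveRoot hcl _ hn hσn hσ
      (hζ.of_map_of_injective (algebraMap K (AlgebraicClosure K)).injective))
  · rintro rfl
    have : Fact n.Prime := ⟨(CharP.char_is_prime_or_zero K n).resolve_right hp.ne'⟩
    exact (EssDim.essDim_eq_one_iff hn).2 (EssDim.exists_faithful_of_charP hcl n _ hσn hσ)
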